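/- Setting. Let $S\subset\mathbb R^n$ be an unbounded locally compact set with $0\in S$, let $E=S\cup\{\infty\}$ be its Alexandroff one-point compactification with its Borel $\sigma$-field, let $E^\circ=\mathring S\setminus\{0\}$ ($\mathring S$ being the interior of $S$ in $\mathbb R^n$) and $\partial E=E\setminus E^\circ$. Let $X=((X_t)_{t\ge 0},(\mathbb P_x)_{x\in E})$ be a standard Markov process on $E$: $\mathbb P_x(X_0=x)=1$, the paths are right continuous with left limits, $X$ is strong Markov with respect to a right-continuous complete filtration and quasi-left continuous on $[0,\zeta)$, where $\zeta=\inf\{s>0: X_s\notin E^\circ\}$. The points of $\partial E$ are absorbing; when $X$ leaves $E^\circ$ it is sent to $0$ or $\infty$ (to $0$ if it leaves through $\partial S\cup\{0\}$, to $\infty$ if it leaves through $\infty$); and, started at any point of $E^\circ$, $X$ reaches every nonempty open subset of $E$ with positive probability. A Borel function $h:E\to[0,\infty]$ is excessive if $\mathbb E_x h(X_t)\le h(x)$ for all $x,t$ and $\lim_{t\to0+}\mathbb E_xh(X_t)=h(x)$ for all $x$; put $E_h=\{x\in E:0<h(x)<\infty\}$. The Doob transform $X^h$ (killed on leaving $E^\circ$)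 is the sub-Markovian process with semigroup $P^h_t(x,dy)=\frac{h(y)}{h(x)}\,\mathbb P_x(X_t\in dy,\ t<\zeta)$ for $x\in E_h$, and $P_t^h(x,\cdot)=0$ for $x\notin E_h$. $X$ has the inversion property with characteristics $(I,h,v)$ if $I\ne\mathrm{Id}$ is a Borel involution of $E$, $h$ is excessive with $0<h<\infty$ on $E^\circ$, $v$ is a positive continuous function on $E^\circ$, and for every $x\in E$ the process $(I(X_{\gamma_t}))_{0\le t<A_\zeta}$ under $\mathbb P_x$ has the same law (finite-dimensional distributions) as $X^h$ started at $I(x)$, where $\gamma$ is the inverse of $A_t=\int_0^{t\wedge\zeta}v(X_s)^{-1}ds$. For $B\subset E$ let $\tau_B=\inf\{s>0:X_s\notin B\}$. Functions take values in $[-\infty,\infty]$. A Borel function $f$ on $E$ is regular harmonic on $D$ if, for every $x\in D$, $f(X_{\tau_D})\mathbf 1_{\{\tau_D<\infty\}}$ is $\mathbb P_x$-integrable and $\mathbb E_x(f(X_{\tau_D}),\tau_D<\infty)=f(x)$. It is superharmonic on $D$ if, for every open $B$ with $\overline B\subset D$ (closure in the compact space $E$) and every $x\in B$, the expectation $\mathbb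 E_x(f(X_{\tau_B}),\tau_B<\infty)$ exists in $[-\infty,\infty]$ and is at most $f(x)$. Theorem. Let $X$ be a standard Markov process on $E$ as above that has the inversion property with characteristics $(I,h,v)$, and assume that $I(U)$ is open for every open $U\subset E_h$ (so that these notions make sense on $I(U)$). Let $D\subset E_h$ be open. Then the Kelvin transform $\mathcal Kf(x)=h(x)f(I(x))$ (with $\infty\cdot0=0$) has the following properties. (i) If $f$ is regular harmonic on $D$ and $f=0$ on $\partial E\setminus D$ (in particular, if $f=0$ on $E\setminus D$ or on $\partial E$), then $\mathcal Kf$ is regular harmonic on $I(D)$. (ii) If $f$ is superharmonic on $D$ and $f=0$ on $\partial E$, then $\mathcal Kf$ is superharmonic on $I(D)$. -/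

import Mathlib

open MeasureTheory Filter Topology
open scoped NNReal ENNReal

noncomputable section

namespace KelvinIP

/-- The one-point compactification `OnePoint S` carries its Borel σ-field. -/
instance instMeasurableSpaceOnePoint {α : Type*} [TopologicalSpace α] :
    MeasurableSpace (OnePoint α) := borel (OnePoint α)

instance instBorelSpaceOnePoint {α : Type*} [TopologicalSpace α] :
    BorelSpace (OnePoint α) := ⟨rfl⟩

/-- The state space `E`: the Alexandroff compactification of `S ⊆ ℝⁿ` (subspace topology). -/
abbrev E {n : ℕ} (S : Set (EuclideanSpace ℝ (Fin n))) : Type := OnePoint S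

/-- The interior `E° = S° \ {0}` of the state space; `S°` is the interior of `S` in `ℝⁿ`.
Its complement is the boundary `∂E = ∂S ∪ {0, ∞}`. -/
def inner {n : ℕ} (S : Set (EuclideanSpace ℝ (Fin n))) : Set (E S) :=
  {z | ∃ x : S, (x : EuclideanSpace ℝ (Fin n)) ∈ interior S ∧
    (x : EuclideanSpace ℝ (Fin n)) ≠ 0 ∧ z = (x : OnePoint S)}

/-- `z` is the point `0 ∈ S ⊆ E`. -/
def IsOrigin {n : ℕ} {S : Set (EuclideanSpace ℝ (Fin n))} (z : E S) : Prop :=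
  ∃ x : S, (x : EuclideanSpace ℝ (Fin n)) = 0 ∧ z = (x : OnePoint S)

/-- The first exit time `τ_B = inf {s > 0 : X_s ∉ B}`, with `inf ∅ = ∞`. -/
def exitTime {Ω F : Type*} (X : ℝ≥0 → Ω → F) (B : Set F) (ω : Ω) : ℝ≥0∞ :=
  ⨅ (s : ℝ≥0) (_ : 0 < s ∧ X s ω ∉ B), (s : ℝ≥0∞)

/-- The event `A` lies in the σ-field `m` completed by the `μ`-null sets. -/
def AEIn {Ω : Type*} {m₀ : MeasurableSpace Ω} (μ : Measure Ω) (m : MeasurableSpace Ω)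
    (A : Set Ω) : Prop :=
  ∃ B, MeasurableSet[m] B ∧ A =ᵐ[μ] B

/-- `T` is a stopping time of the right-continuous `μ`-completion of the filtration `𝓕`. -/
def IsAugStopping {Ω : Type*} {m₀ : MeasurableSpace Ω} (μ : Measure Ω)
    (𝓕 : Filtration ℝ≥0 m₀) (T : Ω → ℝ≥0∞) : Prop :=
  ∀ t : ℝ≥0, AEIn μ (𝓕 t) {ω | T ω < t}

/-- Up to `{T = ∞}`, the event `A` lies in the σ-field of the stopping time `T`, for the
right-continuous `μ`-completion of the filtration `𝓕`. -/
def BeforeStopping {Ω : Type*} {m₀ : MeasurableSpace Ω} (μ : Measure Ω)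
    (𝓕 : Filtration ℝ≥0 m₀) (T : Ω → ℝ≥0∞) (A : Set Ω) : Prop :=
  ∀ t : ℝ≥0, AEIn μ (𝓕 t) (A ∩ {ω | T ω < t})

/-- A standard Markov process on `E`. The strong Markov property and the quasi-left continuity
refer to stopping times of the usual (right-continuous, complete) augmentation of the
filtration `𝓕` under each `P x`. -/
structure StandardProcess {n : ℕ} (S : Set (EuclideanSpace ℝ (Fin n)))
    (Ω : Type*) [m₀ : MeasurableSpace Ω] where
  /-- the process -/
  X : ℝ≥0 → Ω → E S
  /-- the laws of the process started at the points of `E` -/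
  P : E S → Measure Ω
  /-- the filtration -/
  𝓕 : Filtration ℝ≥0 m₀
  prob : ∀ x, IsProbabilityMeasure (P x)
  start : ∀ x, ∀ᵐ ω ∂(P x), X 0 ω = x
  adapted : ∀ t, Measurable[𝓕 t] (X t)
  measurable_transition : ∀ (t : ℝ≥0) (B : Set (E S)), MeasurableSet B →
    Measurable fun x => P x {ω | X t ω ∈ B}
  right_continuous : ∀ ω t, ContinuousWithinAt (fun s => X s ω) (Set.Ici t) t
  left_limits : ∀ ω (t : ℝ≥0), 0 < t → ∃ l, Tendsto (fun s => X s ω) (𝓝[<] t) (𝓝 l)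
  strong_markov : ∀ (x : E S) (T : Ω → ℝ≥0∞) (A : Set Ω),
    IsAugStopping (P x) 𝓕 T → BeforeStopping (P x) 𝓕 T A →
    ∀ (t : ℝ≥0) (B : Set (E S)), MeasurableSet B →
      P x (A ∩ {ω | T ω < ∞ ∧ X ((T ω).toNNReal + t) ω ∈ B})
        = ∫⁻ ω in A ∩ {ω | T ω < ∞}, P (X (T ω).toNNReal ω) {η | X t η ∈ B} ∂(P x)
  quasi_left : ∀ (x : E S) (T : ℕ → Ω → ℝ≥0∞),
    (∀ k, IsAugStopping (P x) 𝓕 (T k)) → (∀ ω, Monotone fun k => T k ω) →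
    ∀ᵐ ω ∂(P x), (⨆ k, T k ω) < exitTime X (inner S) ω →
      Tendsto (fun k => X (T k ω).toNNReal ω) atTop (𝓝 (X (⨆ k, T k ω).toNNReal ω))
  /-- the points of `∂E` are absorbing -/
  absorbed : ∀ ω (s t : ℝ≥0), s ≤ t → X s ω ∉ inner S → X t ω = X s ω
  /-- on leaving `E°` the process is sent to `0` or to `∞` -/
  exit_mem : ∀ ω (t : ℝ≥0), X 0 ω ∈ inner S → exitTime X (inner S) ω = t →
    IsOrigin (X t ω) ∨ X t ω = OnePoint.infty
  /-- it is sent to `0` if it leaves through `∂S ∪ {0}` -/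
  exit_origin : ∀ ω (t : ℝ≥0) (l : E S), X 0 ω ∈ inner S → exitTime X (inner S) ω = t →
    Tendsto (fun s => X s ω) (𝓝[<] t) (𝓝 l) → l ∉ inner S → l ≠ OnePoint.infty →
    IsOrigin (X t ω)
  /-- it is sent to `∞` if it leaves through `∞` -/
  exit_infty : ∀ ω (t : ℝ≥0), X 0 ω ∈ inner S → exitTime X (inner S) ω = t →
    Tendsto (fun s => X s ω) (𝓝[<] t) (𝓝 OnePoint.infty) → X t ω = OnePoint.infty
  /-- every nonempty open set is reached with positive probability from each point of `E°` -/
  irreducible : ∀ x ∈ inner S, ∀ U : Set (E S), IsOpen U → U.Nonempty →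
    0 < P x {ω | ∃ t, X t ω ∈ U}

namespace StandardProcess

variable {n : ℕ} {S : Set (EuclideanSpace ℝ (Fin n))} {Ω : Type*} [MeasurableSpace Ω]

/-- The lifetime `ζ`, the first exit time from `E°`. -/
def lifetime (Z : StandardProcess S Ω) (ω : Ω) : ℝ≥0∞ := exitTime Z.X (inner S) ω

/-- `h : E → [0, ∞]` is excessive. -/
def Excessive (Z : StandardProcess S Ω) (h : E S → ℝ≥0∞) : Prop :=
  Measurable h ∧ (∀ x t, ∫⁻ ω, h (Z.X t ω) ∂(Z.P x) ≤ h x) ∧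
    ∀ x, Tendsto (fun t : ℝ≥0 => ∫⁻ ω, h (Z.X t ω) ∂(Z.P x)) (𝓝[>] 0) (𝓝 (h x))

/-- The semigroup `Q_t(x, dy) = P_x(X_t ∈ dy, t < ζ)` of `X` killed on leaving `E°`. -/
def killed (Z : StandardProcess S Ω) (t : ℝ≥0) (x : E S) : Measure (E S) :=
  ((Z.P x).restrict {ω | (t : ℝ≥0∞) < Z.lifetime ω}).map (Z.X t)

open Classical in
/-- The semigroup `P_t^h(x, dy) = (h(y) / h(x)) Q_t(x, dy)` of the Doob `h`-transform of `X`
(killed on leaving `E°`); it is `0` if `h(x)` is `0` or `∞`. -/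
def doob (Z : StandardProcess S Ω) (h : E S → ℝ≥0∞) (t : ℝ≥0) (x : E S) : Measure (E S) :=
  if 0 < h x ∧ h x < ∞ then (h x)⁻¹ • (Z.killed t x).withDensity h else 0

/-- The additive functional `A_t = ∫₀ᵗ v(X_s)⁻¹ ds`, stopped at the lifetime. -/
def clock (Z : StandardProcess S Ω) (v : E S → ℝ) (t : ℝ≥0∞) (ω : Ω) : ℝ≥0∞ :=
  ∫⁻ s in {s : ℝ | 0 ≤ s ∧ ENNReal.ofReal s < min t (Z.lifetime ω)},
    ENNReal.ofReal (v (Z.X s.toNNReal ω))⁻¹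

/-- The inverse `γ_t = inf {s : A_s > t}` of the additive functional; used for `t < A_ζ`. -/
def invClock (Z : StandardProcess S Ω) (v : E S → ℝ) (t : ℝ≥0) (ω : Ω) : ℝ≥0 :=
  sInf {s : ℝ≥0 | (t : ℝ≥0∞) < Z.clock v s ω}

open Classical in
/-- The process `I(X_{γ_t})`, alive (`some`) for `t < A_ζ` and dead (`none`) afterwards. -/
def inverted (Z : StandardProcess S Ω) (I : E S → E S) (v : E S → ℝ) (t : ℝ≥0) (ω : Ω) :
    Option (E S) :=
  if (t : ℝ≥0∞) < Z.clock v ∞ ω then some (I (Z.X (Z.invClock v t ω) ω)) else none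

end StandardProcess

/-- For a list `(r₁, B₁), …, (r_k, B_k)`, the event that `Y` is alive and lies in `B_i` at each
time `s + r₁ + ⋯ + r_i`. -/
def fddEvent {Ω F : Type*} (Y : ℝ≥0 → Ω → Option F) : ℝ≥0 → List (ℝ≥0 × Set F) → Set Ω
  | _, [] => Set.univ
  | s, p :: l => {ω | ∃ y ∈ p.2, Y (s + p.1) ω = some y} ∩ fddEvent Y (s + p.1) l

/-- For a list `(r₁, B₁), …, (r_k, B_k)`, the mass
`∫_{B₁} P_{r₁}(x, dy₁) ∫_{B₂} P_{r₂}(y₁, dy₂) ⋯ ∫_{B_k} P_{r_k}(y_{k-1}, dy_k)`. -/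
def fddMass {F : Type*} [MeasurableSpace F] (Q : ℝ≥0 → F → Measure F) :
    List (ℝ≥0 × Set F) → F → ℝ≥0∞
  | [], _ => 1
  | p :: l, x => ∫⁻ y in p.2, fddMass Q l y ∂(Q p.1 x)

/-- Under `μ`, the process `Y` has the law of the (sub-Markovian) Markov process with transition
semigroup `Q` started at `x`: the finite-dimensional distributions agree. -/
def HasMarkovLaw {Ω F : Type*} [MeasurableSpace Ω] [MeasurableSpace F]
    (μ : Measure Ω) (Y : ℝ≥0 → Ω → Option F) (Q : ℝ≥0 → F → Measure F) (x : F) : Prop :=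
  ∀ l : List (ℝ≥0 × Set F), (∀ p ∈ l, MeasurableSet p.2) →
    μ (fddEvent Y 0 l) = fddMass Q l x

/-- `X` has the inversion property with characteristics `(I, h, v)`: for every `x`, the process
`I(X_{γ_t})` under `P_x` has the law of the Doob transform `X^h` started at `I(x)`. -/
structure InversionProperty {n : ℕ} {S : Set (EuclideanSpace ℝ (Fin n))} {Ω : Type*}
    [MeasurableSpace Ω] (Z : StandardProcess S Ω) (I : E S → E S) (h : E S → ℝ≥0∞)
    (v : E S → ℝ) : Prop where
  involutive : Function.Involutive I
  ne_id : I ≠ id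
  measurable : Measurable I
  excessive : Z.Excessive h
  h_pos : ∀ x ∈ inner S, 0 < h x
  h_lt_top : ∀ x ∈ inner S, h x < ∞
  v_continuous : ContinuousOn v (inner S)
  v_pos : ∀ x ∈ inner S, 0 < v x
  law : ∀ x, HasMarkovLaw (Z.P x) (Z.inverted I v) (Z.doob h) (I x)

/-- `E_h = {x : 0 < h(x) < ∞}`. -/
def finitePos {F : Type*} (h : F → ℝ≥0∞) : Set F := {x | 0 < h x ∧ h x < ∞}

/-- The Kelvin transform `𝒦f = h · (f ∘ I)`, with the convention `∞ · 0 = 0`. -/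
def kelvin {F : Type*} (h : F → ℝ≥0∞) (I : F → F) (f : F → EReal) (x : F) : EReal :=
  (h x : EReal) * f (I x)

namespace StandardProcess

variable {n : ℕ} {S : Set (EuclideanSpace ℝ (Fin n))} {Ω : Type*} [MeasurableSpace Ω]

/-- `E_x (g(X_{τ_B}), τ_B < ∞)` for `g ≥ 0`. -/
def exitMean (Z : StandardProcess S Ω) (B : Set (E S)) (g : E S → ℝ≥0∞) (x : E S) : ℝ≥0∞ :=
  ∫⁻ ω in {ω | exitTime Z.X B ω < ∞}, g (Z.X (exitTime Z.X B ω).toNNReal ω) ∂(Z.P x)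

/-- `E_x (f⁺(X_{τ_B}), τ_B < ∞)`. -/
def exitPos (Z : StandardProcess S Ω) (B : Set (E S)) (f : E S → EReal) (x : E S) : ℝ≥0∞ :=
  Z.exitMean B (fun y => (f y).toENNReal) x

/-- `E_x (f⁻(X_{τ_B}), τ_B < ∞)`. -/
def exitNeg (Z : StandardProcess S Ω) (B : Set (E S)) (f : E S → EReal) (x : E S) : ℝ≥0∞ :=
  Z.exitMean B (fun y => (-f y).toENNReal) x

/-- The Borel function `f` is regular harmonic on `D`: `f(X_{τ_D})` is integrable on
`{τ_D < ∞}`, with `E_x (f(X_{τ_D}), τ_D < ∞) = f(x)`, for every `x ∈ D`. -/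
def RegularHarmonicOn (Z : StandardProcess S Ω) (D : Set (E S)) (f : E S → EReal) : Prop :=
  Measurable f ∧ ∀ x ∈ D, Z.exitPos D f x < ∞ ∧ Z.exitNeg D f x < ∞ ∧
    (Z.exitPos D f x : EReal) - (Z.exitNeg D f x : EReal) = f x

/-- The Borel function `f` is superharmonic on `D`: for every open `B` with closure in `D` and
every `x ∈ B`, the expectation `E_x (f(X_{τ_B}), τ_B < ∞)` exists in `[-∞, ∞]` and is at most
`f(x)`. The closure is taken in the compact space `E`, so such a `B` is relatively compact
in `D`. -/
def SuperharmonicOn (Z : StandardProcess S Ω) (D : Set (E S)) (f : E S → EReal) : Prop :=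
  Measurable f ∧ ∀ B : Set (E S), IsOpen B → closure B ⊆ D → ∀ x ∈ B,
    (Z.exitPos B f x < ∞ ∨ Z.exitNeg B f x < ∞) ∧
    (Z.exitPos B f x : EReal) - (Z.exitNeg B f x : EReal) ≤ f x

end StandardProcess

end KelvinIP

end

/-! ### Compact exhaustions in the one-point compactification -/

noncomputable section

namespace KelvinIP

/-! The inversion property says that `X` started at `I x`, killed at `ζ` and weighted by `h`, is the
image under `I` of a time change of `X` started at `x`. A time change does not affect the place
where a path leaves a set. Hence if `V' ∩ E° = I(V ∩ E°)`, `x ∈ V ∩ E°` and `g ≥ 0` is Borel and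
zero on `∂E`, then `E_{Ix}[h(X_τ') g(I X_τ'); τ' < ∞] = h(Ix) E_x[g(X_τ); τ < ∞]`, where `τ'` and
`τ` are the exit times of `V'` and `V`. This is `exitMean_kelvin`. Applied to the positive and
negative parts of `f` it gives both claims at points of `E°`; at absorbing points both sides vanish.

The work lies in passing from finite-dimensional distributions to exit positions. Three ideas carry
it.

Exit times are replaced by escape times from a compact exhaustion, read off rational times only, so
that they are measurable functions on the product space of all paths. Quasi-left continuity confines
a path that stays in `U` during `[0, s]`, `s < ζ`, to one compact subset of `U`
(`ae_compact_containment`), so that escape and exit agree before `ζ`. Since `I` is a homeomorphism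
of `E°`, escape is also compatible with `I` and with the time change (`turned_escape_iff`).

At a fixed time `t`, the Markov property telescopes the weights of the `h`-transform, and a π-system
argument compares all events of the path frozen at `t` (`law_freeze`).

A fixed time becomes the escape time `e` by averaging (`law_escape`): integrate the fixed-time
identity over `t` with the indicator of `e < t ≤ e + ε`. The strong Markov property rewrites one
side through the means of `h(X_s)` started at `X_e`, `0 < s ≤ ε`; dividing by `ε` and letting `ε →
0`, excessivity of `h` identifies the limit. -/

theorem secondCountable_onePoint {α : Type*} [TopologicalSpace α] [SecondCountableTopology α]
    [LocallyCompactSpace α] [T2Space α] : SecondCountableTopology (OnePoint α) := by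
  classical
  let K : CompactExhaustion α := default
  let b := TopologicalSpace.countableBasis α
  have hb := TopologicalSpace.isBasis_countableBasis α
  -- Every compact set lies in some `K m`, so the complements of the `K m` form a countable
  -- neighbourhood base at `∞`.
  let B : Set (Set (OnePoint α)) :=
    ((fun s : Set α => ((↑) '' s : Set (OnePoint α))) '' b) ∪
      Set.range fun m => ((↑) '' (K m) : Set (OnePoint α))ᶜ
  have hB : TopologicalSpace.IsTopologicalBasis B := by
    refine TopologicalSpace.isTopologicalBasis_of_isOpen_of_nhds ?_ ?_
    · rintro u (⟨s, hs, rfl⟩ | ⟨m, rfl⟩)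
      · exact OnePoint.isOpen_image_coe.2 (hb.isOpen hs)
      · exact OnePoint.isOpen_compl_image_coe.2 ⟨(K.isCompact m).isClosed, K.isCompact m⟩
    · intro a u ha hu
      induction a using OnePoint.rec with
      | infty =>
        obtain ⟨h1, h2⟩ := (OnePoint.isOpen_iff_of_mem ha).1 hu
        obtain ⟨m, hm⟩ := K.exists_superset_of_isCompact h2
        refine ⟨_, Or.inr ⟨m, rfl⟩, by simp, ?_⟩
        intro y hy
        induction y using OnePoint.rec with
        | infty => exact ha
        | coe y =>
          by_contra hyu
          exact hy ⟨y, hm hyu, rfl⟩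
      | coe x =>
        have hu' : IsOpen ((↑) ⁻¹' u : Set α) := hu.preimage OnePoint.continuous_coe
        obtain ⟨s, hs, hxs, hsu⟩ := hb.exists_subset_of_mem_open (a := x) ha hu'
        exact ⟨_, Or.inl ⟨s, hs, rfl⟩, ⟨x, hxs, rfl⟩, by rintro _ ⟨y, hy, rfl⟩; exact hsu hy⟩
  exact hB.secondCountableTopology
    (((TopologicalSpace.countable_countableBasis α).image _).union (Set.countable_range _))

theorem isOpen_inner {n : ℕ} (S : Set (EuclideanSpace ℝ (Fin n))) : IsOpen (inner S) := by
  have : inner S = ((↑) '' {x : S | (x : EuclideanSpace ℝ (Fin n)) ∈ interior S ∧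
      (x : EuclideanSpace ℝ (Fin n)) ≠ 0} : Set (OnePoint S)) := by
    ext z; constructor
    · rintro ⟨x, h1, h2, rfl⟩; exact ⟨x, ⟨h1, h2⟩, rfl⟩
    · rintro ⟨x, ⟨h1, h2⟩, rfl⟩; exact ⟨x, h1, h2, rfl⟩
  rw [this, OnePoint.isOpen_image_coe]
  exact (isOpen_interior.preimage continuous_subtype_val).inter
    (isOpen_ne.preimage continuous_subtype_val)

/-- An increasing sequence of compact subsets of `U` whose interiors cover `U`. -/
structure Exhausts {F : Type*} [TopologicalSpace F] (K : ℕ → Set F) (U : Set F) : Prop where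
  compact : ∀ m, IsCompact (K m)
  mono : Monotone K
  subset : ∀ m, K m ⊆ U
  cover : ∀ x ∈ U, ∃ m, x ∈ interior (K m)

theorem exists_exhausts {F : Type*} [TopologicalSpace F] [LocallyCompactSpace F]
    [SecondCountableTopology F] {U : Set F} (hU : IsOpen U) : ∃ K, Exhausts K U := by
  have : LocallyCompactSpace U := hU.locallyCompactSpace
  let K : CompactExhaustion U := default
  refine ⟨fun m => Subtype.val '' K m, fun m => (K.isCompact m).image continuous_subtype_val,
    fun a b hab => Set.image_mono (K.subset hab), fun m => by simp, fun x hx => ?_⟩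
  obtain ⟨m, hm⟩ := K.exists_mem ⟨x, hx⟩
  refine ⟨m + 1, mem_interior.2 ⟨Subtype.val '' interior (K (m + 1)),
    Set.image_mono interior_subset, hU.isOpenMap_subtype_val _ isOpen_interior,
    ⟨x, hx⟩, K.subset_interior_succ m hm, rfl⟩⟩

/-! ### Escape times as functionals of a path at rational times -/

section Path

variable {F : Type*}

/-- The supremum over `m` of the infima of the rational times at which the path `w` is outside
`K m`. -/
def escape (K : ℕ → Set F) (w : ℝ≥0 → F) : ℝ≥0∞ :=
  ⨆ m, ⨅ (q : ℚ≥0) (_ : w q ∉ K m), ((q : ℝ≥0) : ℝ≥0∞)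

/-- The paths whose values right after the time `escape K w` lie in some fixed `G j`. -/
def escapeIn (K G : ℕ → Set F) : Set (ℝ≥0 → F) :=
  {w | ∃ (j : ℕ) (r : ℚ≥0), escape K w < ((r : ℝ≥0) : ℝ≥0∞) ∧
    ∀ q : ℚ≥0, escape K w < ((q : ℝ≥0) : ℝ≥0∞) → q < r → w q ∈ G j}

theorem measurable_escape [MeasurableSpace F] {K : ℕ → Set F} (hK : ∀ m, MeasurableSet (K m)) :
    Measurable (escape K) := by
  classical
  refine Measurable.iSup fun m => Measurable.iInf fun q => ?_
  have : (fun w : ℝ≥0 → F => ⨅ (_ : w q ∉ K m), ((q : ℝ≥0) : ℝ≥0∞)) =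
      fun w => if w q ∈ (K m)ᶜ then ((q : ℝ≥0) : ℝ≥0∞) else ∞ := by
    funext w
    by_cases hw : w q ∈ K m <;> simp [hw]
  rw [this]
  exact Measurable.ite ((hK m).compl.preimage (measurable_pi_apply _)) measurable_const
    measurable_const

theorem measurableSet_escapeIn [MeasurableSpace F] {K G : ℕ → Set F}
    (hK : ∀ m, MeasurableSet (K m)) (hG : ∀ m, MeasurableSet (G m)) :
    MeasurableSet (escapeIn K G) := by
  have he := measurable_escape hK
  have : escapeIn K G = ⋃ (j : ℕ) (r : ℚ≥0),
      {w | escape K w < ((r : ℝ≥0) : ℝ≥0∞)} ∩ ⋂ q : ℚ≥0,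
        ({w | escape K w < ((q : ℝ≥0) : ℝ≥0∞)}ᶜ ∪ ({_w | q < r}ᶜ ∪ {w | w q ∈ G j})) := by
    ext w
    simp only [escapeIn, Set.mem_ofPred_eq, Set.mem_iUnion, Set.mem_inter_iff, Set.mem_iInter,
      Set.mem_union, Set.mem_compl_iff]
    refine exists_congr fun j => exists_congr fun r => and_congr_right fun _ =>
      forall_congr' fun q => ?_
    tauto
  rw [this]
  exact MeasurableSet.iUnion fun j => MeasurableSet.iUnion fun r =>
    (measurableSet_lt he measurable_const).inter (MeasurableSet.iInter fun q =>
      (measurableSet_lt he measurable_const).compl.union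
        ((MeasurableSet.const _).compl.union ((hG j).preimage (measurable_pi_apply _))))

theorem exists_nnrat_btwn {a b : ℝ≥0∞} (h : a < b) :
    ∃ q : ℚ≥0, a < ((q : ℝ≥0) : ℝ≥0∞) ∧ ((q : ℝ≥0) : ℝ≥0∞) < b := by
  obtain ⟨c, h1, h2⟩ := ENNReal.lt_iff_exists_nnreal_btwn.1 h
  obtain ⟨d, h3, h4⟩ := ENNReal.lt_iff_exists_nnreal_btwn.1 h2
  have h3' : c < d := by exact_mod_cast h3
  obtain ⟨q, hq1, hq2⟩ := exists_rat_btwn (show (c : ℝ) < d by exact_mod_cast h3')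
  have hq0 : 0 ≤ q := by
    have : (0 : ℝ) < q := lt_of_le_of_lt c.2 hq1
    exact_mod_cast this.le
  lift q to ℚ≥0 using hq0
  refine ⟨q, h1.trans ?_, lt_trans ?_ h4⟩
  · rw [ENNReal.coe_lt_coe, ← NNReal.coe_lt_coe]
    exact hq1
  · rw [ENNReal.coe_lt_coe, ← NNReal.coe_lt_coe]
    exact hq2

theorem min_iInf_time_le_of_agree {K : Set F} {w w' : ℝ≥0 → F} {t : ℝ≥0} (h : ∀ q < t, w q = w' q) :
    min (⨅ (q : ℚ≥0) (_ : w q ∉ K), ((q : ℝ≥0) : ℝ≥0∞)) t ≤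
    min (⨅ (q : ℚ≥0) (_ : w' q ∉ K), ((q : ℝ≥0) : ℝ≥0∞)) t := by
  refine le_min (le_iInf₂ fun q hq => ?_) (min_le_right _ _)
  by_cases hqt : (q : ℝ≥0) < t
  · exact (min_le_left _ _).trans (iInf₂_le q (by rwa [h _ hqt]))
  · exact (min_le_right _ _).trans (by exact_mod_cast not_lt.1 hqt)

/-- Times `q ≥ t` contribute nothing below the truncation at `t`, and `min` distributes over the
supremum. So `{e < t}` is decided by the path strictly before `t`: the stopping time property in
pathwise form. -/
theorem min_escape_congr {K : ℕ → Set F} {w w' : ℝ≥0 → F} {t : ℝ≥0} (h : ∀ q < t, w q = w' q) :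
    min (escape K w) t = min (escape K w') t := by
  unfold escape
  rw [iSup_inf_eq, iSup_inf_eq]
  exact iSup_congr fun m => le_antisymm (min_iInf_time_le_of_agree h)
    (min_iInf_time_le_of_agree fun q hq => (h q hq).symm)

theorem escape_congr {K : ℕ → Set F} {w w' : ℝ≥0 → F} {t : ℝ≥0} (h : ∀ q < t, w q = w' q)
    (ht : escape K w < t) : escape K w' = escape K w := by
  have := min_escape_congr (K := K) h
  rw [min_eq_left ht.le] at this
  rcases min_choice (escape K w') t with h1 | h1
  · rw [this, h1]
  · rw [h1] at this; exact absurd this ht.ne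

theorem escape_lt_congr {K : ℕ → Set F} {w w' : ℝ≥0 → F} {t : ℝ≥0} (h : ∀ q < t, w q = w' q) :
    escape K w < t ↔ escape K w' < t :=
  ⟨fun ht => by rwa [escape_congr h ht],
   fun ht => by rwa [escape_congr (fun q hq => (h q hq).symm) ht]⟩

/-- The right end `r` of the observation interval may be lowered below `t`, after which only
coordinates on which the paths agree are consulted. -/
theorem mem_escapeIn_of_agree {K G : ℕ → Set F} {w w' : ℝ≥0 → F} {t : ℝ≥0}
    (h : ∀ q < t, w q = w' q) (ht : escape K w < t) (hw : w ∈ escapeIn K G) :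
    w' ∈ escapeIn K G := by
  obtain ⟨j, r, hr, hj⟩ := hw
  have he := escape_congr h ht
  obtain ⟨r', h1, h2⟩ := exists_nnrat_btwn (lt_min hr ht)
  obtain ⟨h2, h3⟩ := lt_min_iff.1 h2
  refine ⟨j, r', he ▸ h1, fun q hq hqr => ?_⟩
  have hqr' : (q : ℝ≥0) < r' := by exact_mod_cast hqr
  rw [← h q (hqr'.trans (by exact_mod_cast h3))]
  exact hj q (he ▸ hq) (hqr.trans (by exact_mod_cast h2))

theorem mem_escapeIn_congr {K G : ℕ → Set F} {w w' : ℝ≥0 → F} {t : ℝ≥0}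
    (h : ∀ q < t, w q = w' q) (ht : escape K w < t) :
    w ∈ escapeIn K G ↔ w' ∈ escapeIn K G :=
  ⟨mem_escapeIn_of_agree h ht,
   mem_escapeIn_of_agree (fun q hq => (h q hq).symm) ((escape_lt_congr h).1 ht)⟩

variable [TopologicalSpace F]

/-- If a right-continuous path takes values in a closed set at rational times just after `s`,
then it does so at `s`. -/
theorem mem_of_rational_right {w : ℝ≥0 → F} {s : ℝ≥0} {C : Set F} {b : ℝ≥0∞} (hC : IsClosed C)
    (hw : ContinuousWithinAt w (Set.Ici s) s) (hb : (s : ℝ≥0∞) < b)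
    (h : ∀ q : ℚ≥0, (s : ℝ≥0∞) < ((q : ℝ≥0) : ℝ≥0∞) → ((q : ℝ≥0) : ℝ≥0∞) < b → w q ∈ C) :
    w s ∈ C := by
  by_contra hs
  have h1 : ∀ᶠ r in 𝓝[Set.Ici s] s, w r ∈ Cᶜ := hw (hC.isOpen_compl.mem_nhds hs)
  have h2 : ∀ᶠ r in 𝓝[>] s, w r ∈ Cᶜ :=
    h1.filter_mono (nhdsWithin_mono _ Set.Ioi_subset_Ici_self)
  obtain ⟨u, hu, hu'⟩ := (mem_nhdsGT_iff_exists_Ioo_subset' (show s < s + 1 by simp)).1 h2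
  obtain ⟨q, hq1, hq2⟩ := exists_nnrat_btwn (lt_min (show (s : ℝ≥0∞) < u by exact_mod_cast hu) hb)
  obtain ⟨hq2, hq3⟩ := lt_min_iff.1 hq2
  exact hu' ⟨by exact_mod_cast hq1, by exact_mod_cast hq2⟩ (h q hq1 hq3)

/-- If `s` precedes the escape from some `K m`, right continuity and closedness of `K m` extend
membership from rational times to `[0, s]`. Conversely, a path in `U` up to `s` remains there up to
some rational `q > s`; `hcc` puts it in one `K m` up to `q`, so the escape time is at least `q`.
Without `hcc` a left limit on the boundary of `U` could make the escape premature. -/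
theorem lt_escape_iff {w : ℝ≥0 → F} {L : ℝ≥0∞} {K : ℕ → Set F} {U : Set F} [T2Space F]
    (hU : IsOpen U) (hK : Exhausts K U)
    (hw : ∀ s : ℝ≥0, (s : ℝ≥0∞) < L → ContinuousWithinAt w (Set.Ici s) s)
    (hcc : ∀ s : ℝ≥0, (s : ℝ≥0∞) < L → (∀ r ≤ s, w r ∈ U) → ∃ m, ∀ r ≤ s, w r ∈ K m)
    {s : ℝ≥0} (hs : (s : ℝ≥0∞) < L) : (s : ℝ≥0∞) < escape K w ↔ ∀ r ≤ s, w r ∈ U := by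
  constructor
  · intro h r hr
    obtain ⟨m, hm⟩ := lt_iSup_iff.1 h
    have hrs : (r : ℝ≥0∞) ≤ s := by exact_mod_cast hr
    refine hK.subset m (mem_of_rational_right (hK.compact m).isClosed (hw r (hrs.trans_lt hs))
      (hrs.trans_lt hm) fun q _ hq => ?_)
    by_contra hqm
    exact absurd hq (not_lt.2 (iInf₂_le q hqm))
  · intro h
    have h1 : ∀ᶠ r in 𝓝[Set.Ici s] s, w r ∈ U := hw s hs (hU.mem_nhds (h s le_rfl))
    have h2 : ∀ᶠ r in 𝓝[>] s, w r ∈ U :=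
      h1.filter_mono (nhdsWithin_mono _ Set.Ioi_subset_Ici_self)
    obtain ⟨u, hu, hu'⟩ := (mem_nhdsGT_iff_exists_Ioo_subset' (show s < s + 1 by simp)).1 h2
    obtain ⟨q, hq1, hq2⟩ :=
      exists_nnrat_btwn (lt_min (show (s : ℝ≥0∞) < u by exact_mod_cast hu) hs)
    obtain ⟨hq2, hq3⟩ := lt_min_iff.1 hq2
    have hqu : (q : ℝ≥0) < u := by exact_mod_cast hq2
    obtain ⟨m, hm⟩ := hcc q hq3 fun r hr => by
      rcases le_or_gt r s with hrs | hrs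
      · exact h r hrs
      · exact hu' ⟨hrs, hr.trans_lt hqu⟩
    refine hq1.trans_le (le_iSup_of_le m (le_iInf₂ fun p hp => ?_))
    by_contra hpq
    exact hp (hm p (by exact_mod_cast (not_le.1 hpq).le))

/-- One direction uses that `G j` is closed, the other that the interiors of the `G j` cover `O`;
right continuity supplies the interval after `s`. The event that the escape position lies in `O` is
thus expressed by countably many coordinates. -/
theorem mem_escapeIn_iff {w : ℝ≥0 → F} {K G : ℕ → Set F} {O : Set F} [T2Space F]
    (hG : Exhausts G O) {s : ℝ≥0} (hs : escape K w = s)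
    (hw : ContinuousWithinAt w (Set.Ici s) s) : w ∈ escapeIn K G ↔ w s ∈ O := by
  constructor
  · rintro ⟨j, r, hr, hj⟩
    rw [hs] at hr hj
    exact hG.subset j (mem_of_rational_right (hG.compact j).isClosed hw hr
      fun q h1 h2 => hj q h1 (by exact_mod_cast h2))
  · intro h
    obtain ⟨j, hj⟩ := hG.cover _ h
    have h1 : ∀ᶠ r in 𝓝[Set.Ici s] s, w r ∈ interior (G j) :=
      hw (isOpen_interior.mem_nhds hj)
    have h2 : ∀ᶠ r in 𝓝[>] s, w r ∈ interior (G j) :=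
      h1.filter_mono (nhdsWithin_mono _ Set.Ioi_subset_Ici_self)
    obtain ⟨u, hu, hu'⟩ := (mem_nhdsGT_iff_exists_Ioo_subset' (show s < s + 1 by simp)).1 h2
    obtain ⟨r, hr1, hr2⟩ := exists_nnrat_btwn (show (s : ℝ≥0∞) < u by exact_mod_cast hu)
    refine ⟨j, r, by rwa [hs], fun q hq hqr => ?_⟩
    rw [hs] at hq
    have hqr' : (q : ℝ≥0) < r := by exact_mod_cast hqr
    exact interior_subset
      (hu' ⟨by exact_mod_cast hq, hqr'.trans (by exact_mod_cast hr2)⟩)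

end Path

instance instSecondCountableE {n : ℕ} (S : Set (EuclideanSpace ℝ (Fin n)))
    [LocallyCompactSpace S] : SecondCountableTopology (OnePoint S) :=
  secondCountable_onePoint

/-! ### Measurability, Markov property, excessive functions and compact containment -/

namespace StandardProcess

variable {n : ℕ} {S : Set (EuclideanSpace ℝ (Fin n))} {Ω : Type*} [m₀ : MeasurableSpace Ω]
  (Z : StandardProcess S Ω)

instance instIsProbabilityMeasure (x : E S) : IsProbabilityMeasure (Z.P x) := Z.prob x

/-- Absorption excludes a return to `E°`; since `E°` is open, right continuity makes the lifetime
strictly larger than any time spent in `E°`. -/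
theorem mem_inner_iff (t : ℝ≥0) (ω : Ω) :
    Z.X t ω ∈ inner S ↔ (t : ℝ≥0∞) < Z.lifetime ω := by
  constructor
  · intro ht
    have h1 : ∀ᶠ r in 𝓝[Set.Ici t] t, Z.X r ω ∈ inner S :=
      Z.right_continuous ω t ((isOpen_inner S).mem_nhds ht)
    have h2 : ∀ᶠ r in 𝓝[>] t, Z.X r ω ∈ inner S :=
      h1.filter_mono (nhdsWithin_mono _ Set.Ioi_subset_Ici_self)
    obtain ⟨u, hu, hu'⟩ := (mem_nhdsGT_iff_exists_Ioo_subset' (show t < t + 1 by simp)).1 h2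
    have hu1 : t < u := hu
    refine lt_of_lt_of_le (b := (u : ℝ≥0∞)) (by exact_mod_cast hu1) (le_iInf₂ fun s hs => ?_)
    by_contra hsu
    have hsu : s < u := by exact_mod_cast not_le.1 hsu
    rcases le_or_gt s t with hst | hst
    · rw [Z.absorbed ω s t hst hs.2] at ht
      exact hs.2 ht
    · exact hs.2 (hu' ⟨hst, hsu⟩)
  · intro ht
    by_contra h
    obtain ⟨s, h1, h2⟩ := ENNReal.lt_iff_exists_nnreal_btwn.1 ht
    have hts : t < s := by exact_mod_cast h1
    have hs : Z.X s ω ∉ inner S := by rwa [Z.absorbed ω t s hts.le h]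
    exact absurd h2 (not_lt.2 (iInf₂_le s ⟨zero_le.trans_lt hts, hs⟩))

theorem measurable_X (t : ℝ≥0) : Measurable (Z.X t) :=
  (Z.adapted t).mono (Z.𝓕.le t) le_rfl

theorem measurable_lifetime : Measurable Z.lifetime := by
  refine measurable_of_Ioi fun a => ?_
  have : Z.lifetime ⁻¹' Set.Ioi a =
      ⋃ (q : ℚ≥0) (_ : a < ((q : ℝ≥0) : ℝ≥0∞)), Z.X q ⁻¹' inner S := by
    ext ω
    simp only [Set.mem_preimage, Set.mem_Ioi, Set.mem_iUnion, exists_prop, Z.mem_inner_iff]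
    exact ⟨fun h => exists_nnrat_btwn h, fun ⟨q, h1, h2⟩ => h1.trans h2⟩
  rw [this]
  exact MeasurableSet.iUnion fun q => MeasurableSet.iUnion fun _ =>
    (isOpen_inner S).measurableSet.preimage (Z.measurable_X q)

theorem measurable_transition_lintegral {u : E S → ℝ≥0∞} (hu : Measurable u) (t : ℝ≥0) :
    Measurable fun y => ∫⁻ ω, u (Z.X t ω) ∂(Z.P y) := by
  have h : Measurable fun y => (Z.P y).map (Z.X t) := by
    refine Measure.measurable_of_measurable_coe _ fun B hB => ?_
    simp_rw [Measure.map_apply (Z.measurable_X t) hB]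
    exact Z.measurable_transition t B hB
  simp_rw [← lintegral_map hu (Z.measurable_X t)]
  exact (Measure.measurable_lintegral hu).comp h

theorem measurable_uncurry [LocallyCompactSpace S] :
    Measurable fun p : ℝ≥0 × Ω => Z.X p.1 p.2 := by
  have hcount : ∀ (b : ℕ → ℝ≥0) (c : ℝ≥0 → ℕ), Measurable c →
      Measurable fun p : ℝ≥0 × Ω => Z.X (b (c p.1)) p.2 := fun b c hc => by
    have h1 : Measurable fun p : ℕ × Ω => Z.X (b p.1) p.2 :=
      measurable_from_prod_countable_right fun k => Z.measurable_X (b k)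
    exact h1.comp ((hc.comp measurable_fst).prodMk measurable_snd)
  -- Approximation of `s` from the right by points of a grid of mesh `1 / (n + 1)`; each `a n` takes
  -- countably many values, which gives joint measurability.
  let a : ℕ → ℝ≥0 → ℝ≥0 := fun n s => ((⌊(n + 1) * s⌋₊ : ℝ≥0) + 1) / (n + 1)
  have ha : ∀ n s, s < a n s := fun n s => by
    simp only [a]
    rw [lt_div_iff₀ (by positivity), mul_comm]
    exact Nat.lt_floor_add_one _
  have ha' : ∀ n s, a n s ≤ s + 1 / (n + 1) := fun n s => by
    simp only [a]
    have h0 : ((n : ℝ≥0) + 1) ≠ 0 := by positivity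
    rw [div_le_iff₀ (by positivity), add_mul s, one_div, inv_mul_cancel₀ h0, mul_comm s]
    gcongr
    exact Nat.floor_le zero_le
  refine measurable_of_tendsto_metrizable
    (f := fun n (p : ℝ≥0 × Ω) => Z.X (a n p.1) p.2) (fun n => ?_) ?_
  · exact hcount (fun k => ((k : ℝ≥0) + 1) / (n + 1)) (fun s => ⌊((n : ℝ≥0) + 1) * s⌋₊)
      (Nat.measurable_floor.comp (measurable_id.const_mul _))
  · rw [tendsto_pi_nhds]
    rintro ⟨s, ω⟩
    refine (Z.right_continuous ω s).tendsto.comp (tendsto_nhdsWithin_iff.2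
      ⟨?_, Eventually.of_forall fun n => (ha n s).le⟩)
    refine tendsto_of_tendsto_of_tendsto_of_le_of_le tendsto_const_nhds (h := fun n : ℕ =>
      s + 1 / ((n : ℝ≥0) + 1)) ?_ (fun n => (ha n s).le) (fun n => ha' n s)
    have := (tendsto_const_nhds (x := s)).add
      (tendsto_one_div_add_atTop_nhds_zero_nat (𝕜 := ℝ≥0))
    simpa using this

theorem strong_markov_lintegral {x : E S} {T : Ω → ℝ≥0∞} {A : Set Ω} (hT : Measurable T)
    (hXT : ∀ t, Measurable fun ω => Z.X ((T ω).toNNReal + t) ω) (hA : MeasurableSet A)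
    (hTs : IsAugStopping (Z.P x) Z.𝓕 T) (hAT : BeforeStopping (Z.P x) Z.𝓕 T A) (t : ℝ≥0)
    {u : E S → ℝ≥0∞} (hu : Measurable u) :
    ∫⁻ ω in A ∩ {ω | T ω < ∞}, u (Z.X ((T ω).toNNReal + t) ω) ∂(Z.P x) =
      ∫⁻ ω in A ∩ {ω | T ω < ∞}, ∫⁻ η, u (Z.X t η) ∂(Z.P (Z.X (T ω).toNNReal ω)) ∂(Z.P x) := by
  set μ := (Z.P x).restrict (A ∩ {ω | T ω < ∞}) with hμ
  have hAm : MeasurableSet (A ∩ {ω | T ω < ∞}) := hA.inter (hT measurableSet_Iio)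
  have hX0 : Measurable fun ω => Z.X (T ω).toNNReal ω := by simpa using hXT 0
  have hκ : Measurable fun y => (Z.P y).map (Z.X t) := by
    refine Measure.measurable_of_measurable_coe _ fun B hB => ?_
    simp_rw [Measure.map_apply (Z.measurable_X t) hB]
    exact Z.measurable_transition t B hB
  -- The strong Markov property for sets is an equality of measures, which can then be integrated
  -- against any measurable `u ≥ 0`.
  have key : μ.map (fun ω => Z.X ((T ω).toNNReal + t) ω) =
      (μ.map fun ω => Z.X (T ω).toNNReal ω).bind fun y => (Z.P y).map (Z.X t) := by
    ext B hB
    rw [Measure.map_apply (hXT t) hB, Measure.bind_apply hB hκ.aemeasurable,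
      lintegral_map (Measure.measurable_measure.1 hκ B hB) hX0, hμ,
      Measure.restrict_apply ((hXT t) hB)]
    simp_rw [Measure.map_apply (Z.measurable_X t) hB]
    rw [← hμ]
    have := Z.strong_markov x T A hTs hAT t B hB
    rw [← hμ] at this
    refine Eq.trans ?_ (this.trans ?_)
    · congr 1
      ext ω
      simp only [Set.mem_inter_iff, Set.mem_preimage, Set.mem_ofPred_eq]
      tauto
    · rfl
  have h1 := lintegral_map (μ := μ) hu (hXT t)
  rw [← h1, key, Measure.lintegral_bind hκ.aemeasurable hu.aemeasurable,
    lintegral_map (f := fun y => ∫⁻ z, u z ∂((Z.P y).map (Z.X t)))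
      ((Measure.measurable_lintegral hu).comp hκ) hX0]
  simp_rw [lintegral_map hu (Z.measurable_X t)]

theorem markov_lintegral (x : E S) {A : Set Ω} {s : ℝ≥0} (hA : MeasurableSet[Z.𝓕 s] A) (t : ℝ≥0)
    {u : E S → ℝ≥0∞} (hu : Measurable u) :
    ∫⁻ ω in A, u (Z.X (s + t) ω) ∂(Z.P x) =
      ∫⁻ ω in A, ∫⁻ η, u (Z.X t η) ∂(Z.P (Z.X s ω)) ∂(Z.P x) := by
  have := Z.strong_markov_lintegral (x := x) (T := fun _ => (s : ℝ≥0∞)) (A := A) measurable_const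
    (fun t => by simpa using Z.measurable_X _) (Z.𝓕.le s _ hA)
    (fun t => ⟨_, MeasurableSet.const _, ae_eq_refl _⟩)
    (fun r => ?_) t hu
  · simpa using this
  · refine ⟨_, ?_, ae_eq_refl _⟩
    rcases lt_or_ge s r with hsr | hsr
    · exact @MeasurableSet.inter _ (Z.𝓕 r) _ _ (Z.𝓕.mono hsr.le _ hA) (@MeasurableSet.const _ (Z.𝓕 r) _)
    · have : A ∩ {_ω : Ω | (s : ℝ≥0∞) < r} = ∅ := by
        ext ω; simp [hsr]
      rw [this]
      exact @MeasurableSet.empty _ (Z.𝓕 r)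

section Excessive

variable {Z} {h : E S → ℝ≥0∞}

theorem Excessive.measurable_indicator (hh : Z.Excessive h) :
    Measurable ((inner S).indicator h) :=
  hh.1.indicator (isOpen_inner S).measurableSet

theorem Excessive.measurable_indicator_X (hh : Z.Excessive h) (t : ℝ≥0) :
    Measurable fun ω => (inner S).indicator h (Z.X t ω) :=
  hh.measurable_indicator.comp (Z.measurable_X t)

theorem Excessive.lintegral_indicator_le (hh : Z.Excessive h) (y : E S) (t : ℝ≥0) :
    ∫⁻ ω, (inner S).indicator h (Z.X t ω) ∂(Z.P y) ≤ (inner S).indicator h y := by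
  by_cases hy : y ∈ inner S
  · rw [Set.indicator_of_mem hy]
    refine le_trans (lintegral_mono fun ω => ?_) (hh.2.1 y t)
    exact Set.indicator_le_self _ _ _
  · rw [Set.indicator_of_notMem hy, nonpos_iff_eq_zero]
    rw [lintegral_eq_zero_iff (hh.measurable_indicator_X t)]
    filter_upwards [Z.start y] with ω hω
    have h0 : Z.X 0 ω ∉ inner S := by rwa [hω]
    have := Z.absorbed ω 0 t zero_le h0
    simp [this, h0]

theorem Excessive.antitone_lintegral_indicator (hh : Z.Excessive h) (y : E S) :
    Antitone fun t : ℝ≥0 => ∫⁻ ω, (inner S).indicator h (Z.X t ω) ∂(Z.P y) := by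
  intro s t hst
  obtain ⟨r, rfl⟩ := exists_add_of_le hst
  have := Z.markov_lintegral y (A := Set.univ) (s := s) MeasurableSet.univ r
    hh.measurable_indicator
  simp only [Measure.restrict_univ] at this
  simp only
  rw [this]
  exact lintegral_mono fun ω => hh.lintegral_indicator_le _ r

/-- Excessivity gives convergence without killing. The part to be removed lives on `{ζ ≤ t}`, where
absorption gives `X_t = X_1` for `t ≤ 1`. It is therefore the integral of the single integrable
variable `h(X_1)` over events that decrease to a null set, and it tends to zero. -/
theorem Excessive.tendsto_lintegral_indicator (hh : Z.Excessive h) {y : E S} (hy : y ∈ inner S)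
    (hyt : h y < ∞) :
    Tendsto (fun n : ℕ => ∫⁻ ω, (inner S).indicator h (Z.X (1 / ((n : ℝ≥0) + 1)) ω) ∂(Z.P y))
      atTop (𝓝 (h y)) := by
  let ε : ℕ → ℝ≥0 := fun n => 1 / ((n : ℝ≥0) + 1)
  have hε1 : ∀ n, ε n ≤ 1 := fun n => by
    simp only [ε]
    rw [div_le_one (by positivity)]
    simp
  have hε : Tendsto ε atTop (𝓝 0) := tendsto_one_div_add_atTop_nhds_zero_nat
  have hε' : Tendsto ε atTop (𝓝[>] 0) :=
    tendsto_nhdsWithin_iff.2 ⟨hε, Eventually.of_forall fun n => by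
      simp only [ε, Set.mem_Ioi]; positivity⟩
  have h1 : Tendsto (fun n => ∫⁻ ω, h (Z.X (ε n) ω) ∂(Z.P y)) atTop (𝓝 (h y)) :=
    (hh.2.2 y).comp hε'
  let N : ℕ → Set Ω := fun n => Z.X (ε n) ⁻¹' (inner S)ᶜ
  have hN : ∀ n, MeasurableSet (N n) := fun n =>
    (isOpen_inner S).measurableSet.compl.preimage (Z.measurable_X _)
  have hmono : Antitone N := by
    intro a b hab ω hω
    have : ε b ≤ ε a := by
      simp only [ε]
      gcongr
    simp only [N, Set.mem_preimage, Set.mem_compl_iff] at hω ⊢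
    rwa [Z.absorbed ω _ _ this hω]
  have hfin : ∫⁻ ω, h (Z.X 1 ω) ∂(Z.P y) ≠ ∞ := ((hh.2.1 y 1).trans_lt hyt).ne
  have h2 : Tendsto (fun n => ∫⁻ ω in N n, h (Z.X 1 ω) ∂(Z.P y)) atTop (𝓝 0) := by
    refine tendsto_setLIntegral_zero hfin ?_
    have h3 := tendsto_measure_iInter_atTop (μ := Z.P y) (s := N)
      (fun n => (hN n).nullMeasurableSet) hmono ⟨0, measure_ne_top _ _⟩
    have h4 : Z.P y (⋂ n, N n) = 0 := by
      refine measure_mono_null (t := {ω | ¬ Z.X 0 ω = y}) (fun ω hω h0 => ?_) (Z.start y)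
      have hl : (0 : ℝ≥0∞) < Z.lifetime ω := by
        have := (Z.mem_inner_iff 0 ω).1 (by rwa [h0])
        simpa using this
      obtain ⟨s, hs1, hs2⟩ := ENNReal.lt_iff_exists_nnreal_btwn.1 hl
      have hs1 : 0 < s := by exact_mod_cast hs1
      obtain ⟨m, hm⟩ := (hε.eventually (gt_mem_nhds hs1)).exists
      have := (Z.mem_inner_iff (ε m) ω).2 (lt_trans (by exact_mod_cast hm) hs2)
      exact (Set.mem_iInter.1 hω m) this
    rw [h4] at h3
    exact h3
  have h5 : ∀ n, ∫⁻ ω, h (Z.X (ε n) ω) ∂(Z.P y) =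
      ∫⁻ ω, (inner S).indicator h (Z.X (ε n) ω) ∂(Z.P y) + ∫⁻ ω in N n, h (Z.X 1 ω) ∂(Z.P y) := by
    intro n
    rw [← lintegral_indicator (hN n), ← lintegral_add_left
      (hh.measurable_indicator_X _)]
    refine lintegral_congr fun ω => ?_
    by_cases hω : Z.X (ε n) ω ∈ inner S
    · simp [N, hω]
    · have : Z.X 1 ω = Z.X (ε n) ω := Z.absorbed ω _ _ (hε1 n) hω
      simp [N, hω, this]
  have h6 : ∀ n, ∫⁻ ω, (inner S).indicator h (Z.X (ε n) ω) ∂(Z.P y) =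
      ∫⁻ ω, h (Z.X (ε n) ω) ∂(Z.P y) - ∫⁻ ω in N n, h (Z.X 1 ω) ∂(Z.P y) := by
    intro n
    rw [h5 n, ENNReal.add_sub_cancel_right]
    exact (lt_of_le_of_lt (setLIntegral_le_lintegral _ _) hfin.lt_top).ne
  have h7 := ENNReal.Tendsto.sub h1 h2 (Or.inl hyt.ne)
  rw [tsub_zero] at h7
  exact h7.congr fun n => (h6 n).symm

end Excessive

/-- Under `P x`, a path staying in the open set `U ⊆ E°` during `[0, s]` with `s < ζ` stays in a
compact subset of `U`. -/
theorem ae_compact_containment (x : E S) [LocallyCompactSpace S] {K : ℕ → Set (E S)}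
    {U : Set (E S)} (hK : Exhausts K U) :
    ∀ᵐ ω ∂(Z.P x), ∀ s : ℝ≥0, (s : ℝ≥0∞) < Z.lifetime ω → (∀ r ≤ s, Z.X r ω ∈ U) →
      ∃ m, ∀ r ≤ s, Z.X r ω ∈ K m := by
  let T : ℕ → Ω → ℝ≥0∞ := fun m ω => ⨅ (q : ℚ≥0) (_ : Z.X q ω ∉ K m), ((q : ℝ≥0) : ℝ≥0∞)
  have hT : ∀ m, IsAugStopping (Z.P x) Z.𝓕 (T m) := by
    intro m t
    refine ⟨_, ?_, ae_eq_refl _⟩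
    have : {ω | T m ω < t} = ⋃ (q : ℚ≥0) (_ : (q : ℝ≥0) < t), Z.X q ⁻¹' (K m)ᶜ := by
      ext ω
      simp only [T, Set.mem_ofPred_eq, iInf_lt_iff, Set.mem_iUnion, exists_prop, Set.mem_preimage,
        Set.mem_compl_iff, ENNReal.coe_lt_coe]
      exact exists_congr fun q => and_comm
    rw [this]
    exact MeasurableSet.iUnion fun q => MeasurableSet.iUnion fun hq =>
      ((hK.compact m).isClosed.measurableSet.compl.preimage
        ((Z.adapted q).mono (Z.𝓕.mono hq.le) le_rfl))
  have hmono : ∀ ω, Monotone fun m => T m ω := fun ω a b hab =>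
    le_iInf₂ fun q hq => iInf₂_le q fun h => hq (hK.mono hab h)
  -- If no `K m` contains the path on `[0, s]`, then all `T m ≤ s`, and quasi-left continuity makes
  -- `X` at `T m` converge to a point of `U`. For some large `m` this places `X` at `T m` in the
  -- interior of `K m`, and right continuity keeps it there for a while, contradicting the
  -- definition of `T m` as an infimum.
  filter_upwards [Z.quasi_left x T hT hmono] with ω hω s hs hU
  by_contra! hne
  have hTs : ∀ m, T m ω ≤ s := by
    intro m
    obtain ⟨r, hr, hrK⟩ := hne m
    by_contra hlt
    refine hrK (mem_of_rational_right (hK.compact m).isClosed (Z.right_continuous ω r)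
      (lt_of_le_of_lt (by exact_mod_cast hr) (not_le.1 hlt)) fun q _ hq => ?_)
    by_contra hqm
    exact absurd hq (not_lt.2 (iInf₂_le q hqm))
  have hsup : (⨆ m, T m ω) ≤ s := iSup_le hTs
  have hlim := hω (hsup.trans_lt hs)
  have hmem : Z.X (⨆ m, T m ω).toNNReal ω ∈ U := by
    refine hU _ ?_
    have := ENNReal.toNNReal_mono ENNReal.coe_ne_top hsup
    simpa using this
  obtain ⟨j, hj⟩ := hK.cover _ hmem
  obtain ⟨m, hm, hjm⟩ :=
    ((hlim.eventually (isOpen_interior.mem_nhds hj)).and (eventually_ge_atTop j)).exists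
  have hm' : Z.X (T m ω).toNNReal ω ∈ interior (K m) := interior_mono (hK.mono hjm) hm
  obtain ⟨a, ha⟩ : ∃ a : ℝ≥0, (a : ℝ≥0∞) = T m ω :=
    ⟨_, ENNReal.coe_toNNReal ((hTs m).trans_lt ENNReal.coe_lt_top).ne⟩
  rw [← ha, ENNReal.toNNReal_coe] at hm'
  have h1 : ∀ᶠ r in 𝓝[Set.Ici a] a, Z.X r ω ∈ interior (K m) :=
    Z.right_continuous ω a (isOpen_interior.mem_nhds hm')
  have h2 : ∀ᶠ r in 𝓝[>] a, Z.X r ω ∈ interior (K m) :=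
    h1.filter_mono (nhdsWithin_mono _ Set.Ioi_subset_Ici_self)
  obtain ⟨u, hu, hu'⟩ := (mem_nhdsGT_iff_exists_Ioo_subset' (show a < a + 1 by simp)).1 h2
  have hu1 : a < u := hu
  have h3 : T m ω < u := by rw [← ha]; exact_mod_cast hu1
  obtain ⟨q, hq⟩ := iInf_lt_iff.1 h3
  obtain ⟨hqK, hq⟩ := iInf_lt_iff.1 hq
  have hqu : (q : ℝ≥0) < u := by exact_mod_cast hq
  have haq : a ≤ (q : ℝ≥0) := by
    have : T m ω ≤ ((q : ℝ≥0) : ℝ≥0∞) := iInf₂_le q hqK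
    rw [← ha] at this
    exact_mod_cast this
  rcases haq.eq_or_lt with h | h
  · exact hqK (h ▸ interior_subset hm')
  · exact hqK (interior_subset (hu' ⟨h, hqu⟩))

end StandardProcess

/-- A density on `[0, ζ)` which is positive and locally bounded, and vanishes after `ζ`. -/
structure IsClockRate (φ : ℝ → ℝ≥0∞) (ζ : ℝ≥0∞) : Prop where
  measurable : Measurable φ
  pos : ∀ s : ℝ≥0, (s : ℝ≥0∞) < ζ → 0 < φ s
  zero : ∀ s : ℝ≥0, ζ ≤ s → φ s = 0
  bdd : ∀ s : ℝ≥0, (s : ℝ≥0∞) < ζ → ∃ M : ℝ≥0, ∀ r ≤ s, φ (r : ℝ≥0) ≤ M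

/-! ### Inversion of a continuous, strictly increasing clock -/

namespace IsClockRate

variable {φ : ℝ → ℝ≥0∞} {ζ : ℝ≥0∞}

theorem add_Ico (φ : ℝ → ℝ≥0∞) {s t : ℝ≥0} (hst : s ≤ t) :
    ∫⁻ r in Set.Ico (0 : ℝ) t, φ r =
      (∫⁻ r in Set.Ico (0 : ℝ) s, φ r) + ∫⁻ r in Set.Ico (s : ℝ) t, φ r := by
  rw [← lintegral_union measurableSet_Ico, Set.Ico_union_Ico_eq_Ico s.coe_nonneg
    (show (s : ℝ) ≤ t by exact_mod_cast hst)]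
  exact Set.disjoint_left.2 fun x hx hx' => absurd hx.2 (not_lt.2 hx'.1)

theorem mono (φ : ℝ → ℝ≥0∞) : Monotone fun s : ℝ≥0 => ∫⁻ r in Set.Ico (0 : ℝ) s, φ r := by
  intro s t hst
  simp only
  rw [add_Ico φ hst]
  exact le_self_add

variable (hφ : IsClockRate φ ζ)
include hφ

theorem lipschitz {u : ℝ≥0} (hu : (u : ℝ≥0∞) < ζ) : ∃ M : ℝ≥0, ∀ s t : ℝ≥0, s ≤ t → t ≤ u →
    ∫⁻ r in Set.Ico (s : ℝ) t, φ r ≤ M * edist t s := by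
  obtain ⟨M, hM⟩ := hφ.bdd u hu
  refine ⟨M, fun s t hst htu => ?_⟩
  calc ∫⁻ r in Set.Ico (s : ℝ) t, φ r ≤ ∫⁻ _r in Set.Ico (s : ℝ) t, (M : ℝ≥0∞) := by
        refine setLIntegral_mono' measurableSet_Ico fun r hr => ?_
        have hr0 : 0 ≤ r := s.2.trans hr.1
        lift r to ℝ≥0 using hr0
        exact hM r ((show r ≤ t by exact_mod_cast hr.2.le).trans htu)
    _ = M * edist t s := by
        rw [setLIntegral_const, Real.volume_Ico, edist_dist, NNReal.dist_eq, abs_of_nonneg]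
        simpa using hst

theorem lt_top {u : ℝ≥0} (hu : (u : ℝ≥0∞) < ζ) : ∫⁻ r in Set.Ico (0 : ℝ) u, φ r < ∞ := by
  obtain ⟨M, hM⟩ := hφ.lipschitz hu
  refine (hM 0 u zero_le le_rfl).trans_lt ?_
  exact ENNReal.mul_lt_top ENNReal.coe_lt_top (edist_lt_top _ _)

theorem strictMono {s t : ℝ≥0} (hst : s < t) (hs : (s : ℝ≥0∞) < ζ) :
    ∫⁻ r in Set.Ico (0 : ℝ) s, φ r < ∫⁻ r in Set.Ico (0 : ℝ) t, φ r := by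
  rw [add_Ico φ hst.le]
  refine ENNReal.lt_add_right (hφ.lt_top hs).ne (pos_iff_ne_zero.1 ?_)
  obtain ⟨u, hu1, hu2⟩ := ENNReal.lt_iff_exists_nnreal_btwn.1
    (lt_min hs (show (s : ℝ≥0∞) < t by exact_mod_cast hst))
  obtain ⟨hu2, hu3⟩ := lt_min_iff.1 hu2
  have h1 : s < u := by exact_mod_cast hu1
  have h2 : u < t := by exact_mod_cast hu3
  rw [setLIntegral_pos_iff hφ.measurable]
  refine lt_of_lt_of_le (b := volume (Set.Ico (s : ℝ) u)) ?_ (measure_mono fun r hr => ?_)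
  · rw [Real.volume_Ico]
    simpa using h1
  · refine ⟨?_, hr.1, hr.2.trans (by exact_mod_cast h2)⟩
    have hr0 : 0 ≤ r := s.2.trans hr.1
    lift r to ℝ≥0 using hr0
    have : r < u := by exact_mod_cast hr.2
    exact (hφ.pos r (lt_trans (by exact_mod_cast this) hu2)).ne'

theorem lt_total {s : ℝ≥0} (hs : (s : ℝ≥0∞) < ζ) :
    ∫⁻ r in Set.Ico (0 : ℝ) s, φ r < ∫⁻ r in Set.Ici (0 : ℝ), φ r :=
  (hφ.strictMono (show s < s + 1 by simp) hs).trans_le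
    (lintegral_mono_set Set.Ico_subset_Ici_self)

/-- The total mass is the supremum of the masses of `[0, p)` over rational `p < ζ`, because the
density vanishes after `ζ`. A value below the total is thus below the mass of some `[0, p)`, where
the clock is Lipschitz, and the intermediate value theorem applies. This covers `ζ = ∞` and an
infinite total. -/
theorem exists_eq {q : ℝ≥0} (hq : (q : ℝ≥0∞) < ∫⁻ r in Set.Ici (0 : ℝ), φ r) :
    ∃ s : ℝ≥0, (s : ℝ≥0∞) < ζ ∧ ∫⁻ r in Set.Ico (0 : ℝ) s, φ r = q := by
  let ι := {p : ℚ≥0 // ((p : ℝ≥0) : ℝ≥0∞) < ζ}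
  let A : ι → Set ℝ := fun p => Set.Ico (0 : ℝ) ((p.1 : ℝ≥0) : ℝ)
  have hdir : Directed (· ⊆ ·) A := by
    intro p p'
    rcases le_total p.1 p'.1 with h | h
    · exact ⟨p', Set.Ico_subset_Ico_right (by exact_mod_cast h), le_rfl⟩
    · exact ⟨p, le_rfl, Set.Ico_subset_Ico_right (by exact_mod_cast h)⟩
  have htot : ∫⁻ r in Set.Ici (0 : ℝ), φ r = ⨆ p, ∫⁻ r in A p, φ r := by
    rw [← setLIntegral_iUnion_of_directed φ hdir]
    have hA : MeasurableSet (⋃ p, A p) := MeasurableSet.iUnion fun p => measurableSet_Ico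
    rw [← lintegral_indicator measurableSet_Ici, ← lintegral_indicator hA]
    refine lintegral_congr fun r => ?_
    by_cases hr : 0 ≤ r
    · lift r to ℝ≥0 using hr
      rw [Set.indicator_of_mem (by simp)]
      by_cases hrA : (r : ℝ) ∈ ⋃ p, A p
      · rw [Set.indicator_of_mem hrA]
      · rw [Set.indicator_of_notMem hrA]
        refine hφ.zero r (not_lt.1 fun hlt => hrA ?_)
        obtain ⟨p, hp1, hp2⟩ := exists_nnrat_btwn hlt
        exact Set.mem_iUnion.2 ⟨⟨p, hp2⟩, r.2, by exact_mod_cast hp1⟩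
    · rw [Set.indicator_of_notMem (show r ∉ Set.Ici 0 from hr), Set.indicator_of_notMem]
      simp only [Set.mem_iUnion, not_exists]
      exact fun p hp => hr hp.1
  rw [htot] at hq
  obtain ⟨⟨p, hp⟩, hqp⟩ := lt_iSup_iff.1 hq
  obtain ⟨M, hM⟩ := hφ.lipschitz hp
  let u : ℝ≥0 := p
  -- Stopping the clock at `u` makes it globally Lipschitz, hence continuous, although it may
  -- explode at `ζ`.
  let f : ℝ≥0 → ℝ≥0∞ := fun s => ∫⁻ r in Set.Ico (0 : ℝ) (min s u : ℝ≥0), φ r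
  have hf : Continuous f := by
    refine continuous_of_le_add_edist (M : ℝ≥0∞) ENNReal.coe_ne_top fun x y => ?_
    rcases le_total x y with h | h
    · exact (mono φ (min_le_min_right u h)).trans le_self_add
    · simp only [f]
      rw [add_Ico φ (min_le_min_right u h)]
      gcongr
      refine (hM _ _ (min_le_min_right u h) (min_le_right _ _)).trans ?_
      gcongr
      rw [edist_dist, edist_dist]
      refine ENNReal.ofReal_le_ofReal ?_
      rw [NNReal.dist_eq, NNReal.dist_eq]
      push_cast
      exact abs_min_sub_min_le_max _ _ _ _ |>.trans (by simp)
  have h0 : f 0 = 0 := by simp [f]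
  have hu : f u = ∫⁻ r in A ⟨p, hp⟩, φ r := by simp [f, A, u]
  obtain ⟨s, hs, hsq⟩ := intermediate_value_Icc (f := f) (zero_le (a := u)) hf.continuousOn
    (show (q : ℝ≥0∞) ∈ Set.Icc (f 0) (f u) from ⟨by simp [h0], by rw [hu]; exact hqp.le⟩)
  refine ⟨s, lt_of_le_of_lt (by exact_mod_cast hs.2) hp, ?_⟩
  rw [← hsq]
  simp only [f]
  rw [min_eq_left hs.2]

theorem sInf_eq {q s : ℝ≥0} (hs : (s : ℝ≥0∞) < ζ)
    (h : ∫⁻ r in Set.Ico (0 : ℝ) s, φ r = q) :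
    sInf {t : ℝ≥0 | (q : ℝ≥0∞) < ∫⁻ r in Set.Ico (0 : ℝ) t, φ r} = s := by
  have : {t : ℝ≥0 | (q : ℝ≥0∞) < ∫⁻ r in Set.Ico (0 : ℝ) t, φ r} = Set.Ioi s := by
    ext t
    simp only [Set.mem_ofPred_eq, Set.mem_Ioi, ← h]
    refine ⟨fun hlt => ?_, fun hlt => hφ.strictMono hlt hs⟩
    by_contra hle
    exact absurd hlt (not_lt.2 (mono φ (not_lt.1 hle)))
  rw [this, csInf_Ioi]

end IsClockRate

/-! ### The clock of the process -/

namespace StandardProcess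

variable {n : ℕ} {S : Set (EuclideanSpace ℝ (Fin n))} {Ω : Type*} [m₀ : MeasurableSpace Ω]
  (Z : StandardProcess S Ω)

/-- The rate `1 / v(X_s)` of the clock, extended by `0` beyond the lifetime. -/
def rate (v : E S → ℝ) (ω : Ω) (s : ℝ) : ℝ≥0∞ :=
  (inner S).indicator (fun y => ENNReal.ofReal (v y)⁻¹) (Z.X s.toNNReal ω)

theorem measurable_rate [LocallyCompactSpace S] {v : E S → ℝ} (hv : ContinuousOn v (inner S))
    (hv0 : ∀ x ∈ inner S, 0 < v x) : Measurable fun p : ℝ × Ω => Z.rate v p.2 p.1 := by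
  have h1 : Measurable ((inner S).indicator fun y => ENNReal.ofReal (v y)⁻¹) := by
    classical
    have hc : ContinuousOn (fun y => ENNReal.ofReal (v y)⁻¹) (inner S) :=
      ENNReal.continuous_ofReal.comp_continuousOn (hv.inv₀ fun x hx => (hv0 x hx).ne')
    rw [← Set.piecewise_eq_indicator]
    exact hc.measurable_piecewise continuousOn_const (isOpen_inner S).measurableSet
  exact h1.comp (Z.measurable_uncurry.comp
    ((measurable_real_toNNReal.comp measurable_fst).prodMk measurable_snd))

theorem clock_eq (v : E S → ℝ) (t : ℝ≥0∞) (ω : Ω) :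
    Z.clock v t ω = ∫⁻ s in {s : ℝ | 0 ≤ s ∧ ENNReal.ofReal s < t}, Z.rate v ω s := by
  have hm : ∀ t : ℝ≥0∞, MeasurableSet {s : ℝ | 0 ≤ s ∧ ENNReal.ofReal s < t} := fun t =>
    measurableSet_Ici.inter (measurableSet_lt ENNReal.measurable_ofReal measurable_const)
  unfold clock
  rw [← lintegral_indicator (hm _), ← lintegral_indicator (hm _)]
  refine lintegral_congr fun s => ?_
  by_cases hs : 0 ≤ s ∧ ENNReal.ofReal s < t
  · rw [Set.indicator_of_mem (s := {s : ℝ | 0 ≤ s ∧ ENNReal.ofReal s < t}) hs, rate]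
    by_cases hl : ENNReal.ofReal s < Z.lifetime ω
    · rw [Set.indicator_of_mem (show s ∈ {s : ℝ | 0 ≤ s ∧ ENNReal.ofReal s < min t _} from
        ⟨hs.1, lt_min hs.2 hl⟩), Set.indicator_of_mem ((Z.mem_inner_iff _ ω).2 hl)]
    · rw [Set.indicator_of_notMem (show s ∉ {s : ℝ | 0 ≤ s ∧ ENNReal.ofReal s < min t _} from
        fun h => hl (lt_min_iff.1 h.2).2),
        Set.indicator_of_notMem fun h => hl ((Z.mem_inner_iff _ ω).1 h)]
  · rw [Set.indicator_of_notMem (s := {s : ℝ | 0 ≤ s ∧ ENNReal.ofReal s < t}) hs,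
      Set.indicator_of_notMem fun h => hs ⟨h.1, (lt_min_iff.1 h.2).1⟩]

theorem clock_coe (v : E S → ℝ) (t : ℝ≥0) (ω : Ω) :
    Z.clock v t ω = ∫⁻ s in Set.Ico (0 : ℝ) t, Z.rate v ω s := by
  rw [clock_eq]
  congr 2
  ext s
  simp only [Set.mem_ofPred_eq, Set.mem_Ico]
  refine and_congr_right fun hs => ?_
  exact ENNReal.ofReal_lt_coe_iff hs

theorem clock_top (v : E S → ℝ) (ω : Ω) :
    Z.clock v ∞ ω = ∫⁻ s in Set.Ici (0 : ℝ), Z.rate v ω s := by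
  rw [clock_eq]
  congr 2
  ext s
  simp

theorem measurable_clock [LocallyCompactSpace S] {v : E S → ℝ} (hv : ContinuousOn v (inner S))
    (hv0 : ∀ x ∈ inner S, 0 < v x) (t : ℝ≥0∞) : Measurable (Z.clock v t) := by
  have : Z.clock v t = fun ω => ∫⁻ s in {s : ℝ | 0 ≤ s ∧ ENNReal.ofReal s < t}, Z.rate v ω s := by
    funext ω
    exact Z.clock_eq v t ω
  rw [this]
  exact (Z.measurable_rate hv hv0).lintegral_prod_left'

theorem measurable_invClock [LocallyCompactSpace S] {v : E S → ℝ}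
    (hv : ContinuousOn v (inner S)) (hv0 : ∀ x ∈ inner S, 0 < v x) (t : ℝ≥0) :
    Measurable (Z.invClock v t) := by
  refine measurable_of_Iio fun a => ?_
  -- The second piece accounts for the convention `sInf ∅ = 0` in `ℝ≥0`: if the clock never exceeds
  -- `t`, the inverse is `0`.
  have : Z.invClock v t ⁻¹' Set.Iio a =
      (⋃ (q : ℚ≥0) (_ : (q : ℝ≥0) < a), {ω | (t : ℝ≥0∞) < Z.clock v ((q : ℝ≥0) : ℝ≥0∞) ω}) ∪
        ((⋃ q : ℚ≥0, {ω | (t : ℝ≥0∞) < Z.clock v ((q : ℝ≥0) : ℝ≥0∞) ω})ᶜ ∩ {_ω | 0 < a}) := by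
    ext ω
    have hmono : ∀ s s' : ℝ≥0, s ≤ s' → Z.clock v s ω ≤ Z.clock v s' ω := fun s s' h => by
      rw [clock_coe, clock_coe]
      exact IsClockRate.mono _ h
    simp only [Set.mem_preimage, Set.mem_Iio, Set.mem_union, Set.mem_iUnion, exists_prop,
      Set.mem_ofPred_eq, Set.mem_inter_iff, Set.mem_compl_iff, not_exists]
    by_cases hne : {s : ℝ≥0 | (t : ℝ≥0∞) < Z.clock v s ω}.Nonempty
    · constructor
      · intro h
        obtain ⟨s, hs, hsa⟩ := (csInf_lt_iff (OrderBot.bddBelow _) hne).1 h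
        obtain ⟨q, hq1, hq2⟩ := exists_nnrat_btwn (show (s : ℝ≥0∞) < a by exact_mod_cast hsa)
        exact Or.inl ⟨q, by exact_mod_cast hq2, lt_of_lt_of_le hs
          (hmono _ _ (by exact_mod_cast hq1.le))⟩
      · rintro (⟨q, hqa, hq⟩ | ⟨h, -⟩)
        · exact (csInf_lt_iff (OrderBot.bddBelow _) hne).2 ⟨q, hq, hqa⟩
        · obtain ⟨s, hs⟩ := hne
          obtain ⟨q, hq1, -⟩ := exists_nnrat_btwn (show (s : ℝ≥0∞) < ∞ from ENNReal.coe_lt_top)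
          exact absurd (lt_of_lt_of_le hs (hmono _ _ (by exact_mod_cast hq1.le))) (h q)
    · rw [Set.not_nonempty_iff_eq_empty] at hne
      have h0 : Z.invClock v t ω = 0 := by
        unfold invClock
        rw [hne, NNReal.sInf_empty]
      have hall : ∀ s : ℝ≥0, ¬ (t : ℝ≥0∞) < Z.clock v s ω := fun s hs => by
        have : s ∈ {s : ℝ≥0 | (t : ℝ≥0∞) < Z.clock v s ω} := hs
        rw [hne] at this
        exact this
      simp [h0, hall]
  rw [this]
  refine (MeasurableSet.iUnion fun q => MeasurableSet.iUnion fun _ => ?_).union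
    ((MeasurableSet.iUnion fun q => ?_).compl.inter (MeasurableSet.const _)) <;>
  exact measurableSet_lt measurable_const (Z.measurable_clock hv hv0 _)

/-- Almost surely the clock is finite and locally Lipschitz before the lifetime. -/
theorem ae_isClockRate [LocallyCompactSpace S] {v : E S → ℝ} (hv : ContinuousOn v (inner S))
    (hv0 : ∀ x ∈ inner S, 0 < v x) (x : E S) :
    ∀ᵐ ω ∂(Z.P x), IsClockRate (Z.rate v ω) (Z.lifetime ω) := by
  obtain ⟨K, hK⟩ := exists_exhausts (isOpen_inner S)
  filter_upwards [Z.ae_compact_containment x hK] with ω hω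
  refine ⟨(Z.measurable_rate hv hv0).comp (measurable_id.prodMk measurable_const), fun s hs => ?_,
    fun s hs => ?_, fun s hs => ?_⟩
  · have := (Z.mem_inner_iff s ω).2 hs
    simp only [rate, Real.toNNReal_coe]
    rw [Set.indicator_of_mem this, ENNReal.ofReal_pos]
    exact inv_pos.2 (hv0 _ this)
  · simp only [rate, Real.toNNReal_coe]
    exact Set.indicator_of_notMem (fun h => absurd ((Z.mem_inner_iff s ω).1 h) (not_lt.2 hs)) _
  -- Before `ζ` the path lies in a compact subset of `E°`, on which the continuous function `1 / v`
  -- is bounded.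
  · obtain ⟨m, hm⟩ := hω s hs fun r hr =>
      (Z.mem_inner_iff r ω).2 (lt_of_le_of_lt (by exact_mod_cast hr) hs)
    have hc : ContinuousOn (fun y => (v y)⁻¹) (K m) :=
      (hv.inv₀ fun x hx => (hv0 x hx).ne').mono (hK.subset m)
    obtain ⟨M, hM⟩ := ((hK.compact m).image_of_continuousOn hc).bddAbove
    refine ⟨M.toNNReal, fun r hr => ?_⟩
    simp only [rate, Real.toNNReal_coe]
    rw [Set.indicator_of_mem (hK.subset m (hm r hr))]
    exact ENNReal.ofReal_le_ofReal (hM ⟨_, hm r hr, rfl⟩)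

end StandardProcess

/-- Finite-dimensional events are coded by successive increments, so a finite set of times is sorted
by peeling off its minimum. Inserting `t` makes `t` the last time of the list. One list serves every
process `Y`, which allows it to be used on both sides of the inversion property. -/
theorem exists_list_fddEvent {F : Type*} [MeasurableSpace F] {t : ℝ≥0} {B : ℝ≥0 → Set F}
    (hB : ∀ q, MeasurableSet (B q)) (s : Finset ℝ≥0) :
    ∀ a ≤ t, (∀ q ∈ s, a ≤ q ∧ q ≤ t) → ∃ l : List (ℝ≥0 × Set F),
      (∀ p ∈ l, MeasurableSet p.2) ∧ a + (l.map Prod.fst).sum = t ∧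
      ∀ {Ω : Type*} (Y : ℝ≥0 → Ω → Option F),
        fddEvent Y a l = {ω | ∀ q ∈ insert t s, ∃ y ∈ B q, Y q ω = some y} := by
  induction s using Finset.induction_on_min with
  | empty =>
    intro a ha _
    refine ⟨[(t - a, B t)], by simp [hB], by simp [add_tsub_cancel_of_le ha], fun Y => ?_⟩
    ext ω
    simp [fddEvent, add_tsub_cancel_of_le ha]
  | insert m s hm ih =>
    intro a ha hs
    obtain ⟨ham, hmt⟩ := hs m (Finset.mem_insert_self _ _)
    obtain ⟨l, hl1, hl2, hl3⟩ := ih m hmt fun q hq =>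
      ⟨(hm q hq).le, (hs q (Finset.mem_insert_of_mem hq)).2⟩
    refine ⟨(m - a, B m) :: l, ?_, ?_, fun Y => ?_⟩
    · rintro p hp
      rcases List.mem_cons.1 hp with rfl | hp
      · exact hB m
      · exact hl1 p hp
    · simp only [List.map_cons, List.sum_cons]
      rw [← add_assoc, add_tsub_cancel_of_le ham, hl2]
    · simp only [fddEvent, add_tsub_cancel_of_le ham, hl3]
      ext ω
      simp only [Set.mem_inter_iff, Set.mem_ofPred_eq, Finset.mem_insert, forall_eq_or_imp]
      tauto

/-- The path `w` frozen at the time `t`. -/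
def freeze {F : Type*} (t : ℝ≥0) (w : ℝ≥0 → F) : ℝ≥0 → F := fun q => w (min q t)

theorem freeze_agree {F : Type*} (t : ℝ≥0) (w : ℝ≥0 → F) : ∀ q < t, freeze t w q = w q :=
  fun q hq => by simp [freeze, min_eq_left hq.le]

/-! ### Transfer of the law of the path up to a fixed time -/

namespace StandardProcess

variable {n : ℕ} {S : Set (EuclideanSpace ℝ (Fin n))} {Ω : Type*} [m₀ : MeasurableSpace Ω]
  (Z : StandardProcess S Ω)

open Classical in
/-- The process `X` killed on leaving `E°`. -/
def killedPath (t : ℝ≥0) (ω : Ω) : Option (E S) :=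
  if Z.X t ω ∈ inner S then some (Z.X t ω) else none

theorem exists_killedPath_iff (t : ℝ≥0) (ω : Ω) (B : Set (E S)) :
    (∃ y ∈ B, Z.killedPath t ω = some y) ↔ Z.X t ω ∈ B ∧ Z.X t ω ∈ inner S := by
  unfold killedPath
  by_cases h : Z.X t ω ∈ inner S <;> simp [h]

section Transfer

variable {Z} {h : E S → ℝ≥0∞}

/-- `h(y)` times the mass of the finite-dimensional distributions of `X^h` started at `y`. -/
def scaledMass (Z : StandardProcess S Ω) (h : E S → ℝ≥0∞) (l : List (ℝ≥0 × Set (E S))) :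
    E S → ℝ≥0∞ :=
  (inner S).indicator fun y => h y * fddMass (Z.doob h) l y

/-- The factor `h y` cancels the denominator of the Doob kernel, and the numerator is absorbed in
the scaled mass of the tail. What remains is a recursion along `X` itself, with `h` evaluated only
at the last time. -/
theorem scaledMass_cons (hh : Measurable h) (h0 : ∀ x ∈ inner S, 0 < h x)
    (h1 : ∀ x ∈ inner S, h x < ∞) (p : ℝ≥0 × Set (E S)) (l : List (ℝ≥0 × Set (E S)))
    (hp : MeasurableSet p.2) (hl : Measurable (Z.scaledMass h l)) (y : E S) :
    Z.scaledMass h (p :: l) y =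
      ∫⁻ ω, p.2.indicator (Z.scaledMass h l) (Z.X p.1 ω) ∂(Z.P y) := by
  by_cases hy : y ∈ inner S
  · have hset : {ω | (p.1 : ℝ≥0∞) < Z.lifetime ω} = Z.X p.1 ⁻¹' inner S := by
      ext ω
      exact (Z.mem_inner_iff _ _).symm
    have hms : MeasurableSet (Z.X p.1 ⁻¹' inner S) :=
      (isOpen_inner S).measurableSet.preimage (Z.measurable_X _)
    have hkill : ∀ᵐ z ∂(Z.killed p.1 y), z ∈ inner S := by
      unfold killed
      rw [hset]
      exact (ae_map_iff (Z.measurable_X _).aemeasurable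
        (show MeasurableSet {z | z ∈ inner S} from (isOpen_inner S).measurableSet)).2
        (ae_restrict_mem hms)
    simp only [scaledMass, Set.indicator_of_mem hy, fddMass]
    have hd : Z.doob h p.1 y = (h y)⁻¹ • (Z.killed p.1 y).withDensity h := by
      unfold doob
      rw [if_pos ⟨h0 y hy, h1 y hy⟩]
    rw [hd, Measure.restrict_smul, lintegral_smul_measure, smul_eq_mul, ← mul_assoc,
      ENNReal.mul_inv_cancel (h0 y hy).ne' (h1 y hy).ne, one_mul,
      setLIntegral_withDensity_eq_setLIntegral_mul_non_measurable _ hh _ hp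
        (ae_restrict_of_ae (hkill.mono fun z hz => h1 z hz))]
    have e1 : ∫⁻ z in p.2, (h * fddMass (Z.doob h) l) z ∂(Z.killed p.1 y) =
        ∫⁻ z in p.2, Z.scaledMass h l z ∂(Z.killed p.1 y) := by
      refine lintegral_congr_ae (ae_restrict_of_ae (hkill.mono fun z hz => ?_))
      simp [scaledMass, Set.indicator_of_mem hz]
    rw [e1, ← lintegral_indicator hp, killed, lintegral_map (hl.indicator hp) (Z.measurable_X _),
      hset, ← lintegral_indicator hms]
    refine lintegral_congr fun ω => ?_
    by_cases hω : Z.X p.1 ω ∈ inner S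
    · rw [Set.indicator_of_mem (show ω ∈ Z.X p.1 ⁻¹' inner S from hω)]
      rfl
    · rw [Set.indicator_of_notMem (show ω ∉ Z.X p.1 ⁻¹' inner S from hω)]
      simp [Set.indicator, hω]
  · rw [scaledMass, Set.indicator_of_notMem hy, eq_comm, ← nonpos_iff_eq_zero]
    calc _ ≤ ∫⁻ _ω, (0 : ℝ≥0∞) ∂(Z.P y) := by
          refine lintegral_mono_ae ?_
          filter_upwards [Z.start y] with ω hω
          have h0 : Z.X 0 ω ∉ inner S := by rwa [hω]
          have hX := Z.absorbed ω 0 p.1 zero_le h0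
          rw [hX, hω]
          simp [Set.indicator, scaledMass, hy]
      _ = 0 := lintegral_zero

theorem measurable_scaledMass (hh : Measurable h) (h0 : ∀ x ∈ inner S, 0 < h x)
    (h1 : ∀ x ∈ inner S, h x < ∞) (l : List (ℝ≥0 × Set (E S))) :
    (∀ p ∈ l, MeasurableSet p.2) → Measurable (Z.scaledMass h l) := by
  induction l with
  | nil =>
    intro _
    simpa [scaledMass, fddMass] using hh.indicator (isOpen_inner S).measurableSet
  | cons p l ih =>
    intro hl
    have hm := ih fun q hq => hl q (List.mem_cons_of_mem _ hq)
    have hp := hl p List.mem_cons_self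
    rw [funext (scaledMass_cons hh h0 h1 p l hp hm)]
    exact Z.measurable_transition_lintegral (hm.indicator hp) p.1

theorem setLIntegral_scaledMass (hh : Measurable h) (h0 : ∀ x ∈ inner S, 0 < h x)
    (h1 : ∀ x ∈ inner S, h x < ∞) (x : E S) (l : List (ℝ≥0 × Set (E S))) :
    (∀ p ∈ l, MeasurableSet p.2) → ∀ (s : ℝ≥0) (A : Set Ω), MeasurableSet[Z.𝓕 s] A →
    ∫⁻ ω in A, Z.scaledMass h l (Z.X s ω) ∂(Z.P x) =
      ∫⁻ ω in A ∩ fddEvent Z.killedPath s l,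
        (inner S).indicator h (Z.X (s + (l.map Prod.fst).sum) ω) ∂(Z.P x) := by
  induction l with
  | nil =>
    intro _ s A _
    simp [scaledMass, fddMass, fddEvent]
  | cons p l ih =>
    intro hl s A hA
    have hm := measurable_scaledMass (Z := Z) hh h0 h1 l
      fun q hq => hl q (List.mem_cons_of_mem _ hq)
    have hp := hl p List.mem_cons_self
    have hset : {ω | ∃ y ∈ p.2, Z.killedPath (s + p.1) ω = some y} =
        Z.X (s + p.1) ⁻¹' (p.2 ∩ inner S) := by
      ext ω
      exact Z.exists_killedPath_iff _ _ _
    have hpi := hp.inter (isOpen_inner S).measurableSet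
    have hA' : MeasurableSet[Z.𝓕 (s + p.1)] (A ∩ Z.X (s + p.1) ⁻¹' (p.2 ∩ inner S)) :=
      @MeasurableSet.inter _ (Z.𝓕 (s + p.1)) _ _ (Z.𝓕.mono le_self_add _ hA)
        (Z.adapted (s + p.1) hpi)
    rw [lintegral_congr fun ω => scaledMass_cons hh h0 h1 p l hp hm (Z.X s ω),
      ← Z.markov_lintegral x hA p.1 (hm.indicator hp)]
    simp only [fddEvent, List.map_cons, List.sum_cons, hset]
    rw [← Set.inter_assoc, ← add_assoc,
      ← ih (fun q hq => hl q (List.mem_cons_of_mem _ hq)) (s + p.1) _ hA',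
      Set.inter_comm A, ← Measure.restrict_restrict (hpi.preimage (Z.measurable_X _)),
      ← lintegral_indicator (hpi.preimage (Z.measurable_X _))]
    refine lintegral_congr fun ω => ?_
    by_cases h2 : Z.X (s + p.1) ω ∈ p.2 <;> by_cases h3 : Z.X (s + p.1) ω ∈ inner S <;>
      simp [Set.indicator, h2, h3, scaledMass]

/-- The time-changed and inverted path `I(X_{γ_t})`. -/
def turned (Z : StandardProcess S Ω) (I : E S → E S) (v : E S → ℝ) (ω : Ω) (t : ℝ≥0) : E S :=
  I (Z.X (Z.invClock v t ω) ω)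

theorem measurable_turned [LocallyCompactSpace S] {I : E S → E S} {v : E S → ℝ}
    (hI : Measurable I) (hv : ContinuousOn v (inner S)) (hv0 : ∀ x ∈ inner S, 0 < v x) :
    Measurable (Z.turned I v) :=
  measurable_pi_lambda _ fun t => hI.comp (Z.measurable_uncurry.comp
    ((Z.measurable_invClock hv hv0 t).prodMk measurable_id))

theorem exists_inverted_iff (I : E S → E S) (v : E S → ℝ) (t : ℝ≥0) (ω : Ω) (B : Set (E S)) :
    (∃ y ∈ B, Z.inverted I v t ω = some y) ↔
      Z.turned I v ω t ∈ B ∧ (t : ℝ≥0∞) < Z.clock v ∞ ω := by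
  unfold inverted turned
  by_cases h : (t : ℝ≥0∞) < Z.clock v ∞ ω <;> simp [h]

theorem law_inverted {I : E S → E S} {v : E S → ℝ} (hIP : InversionProperty Z I h v) {x : E S}
    (hx : I x ∈ inner S) (l : List (ℝ≥0 × Set (E S))) (hl : ∀ p ∈ l, MeasurableSet p.2) :
    h (I x) * Z.P x (fddEvent (Z.inverted I v) 0 l) =
      ∫⁻ ω in fddEvent Z.killedPath 0 l,
        (inner S).indicator h (Z.X (l.map Prod.fst).sum ω) ∂(Z.P (I x)) := by
  have h2 := setLIntegral_scaledMass (Z := Z) hIP.excessive.1 hIP.h_pos hIP.h_lt_top (I x) l hl 0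
    Set.univ MeasurableSet.univ
  rw [Set.univ_inter, zero_add, Measure.restrict_univ] at h2
  rw [hIP.law x l hl, ← h2]
  have h3 : ∀ᵐ ω ∂(Z.P (I x)), Z.scaledMass h l (Z.X 0 ω) = h (I x) * fddMass (Z.doob h) l (I x) := by
    filter_upwards [Z.start (I x)] with ω hω
    rw [hω, scaledMass, Set.indicator_of_mem hx]
  rw [lintegral_congr_ae h3]
  simp

/-- Both sides are finite measures in `Λ`. On square cylinders they agree by the inversion property,
and these form a generating π-system. The weight `h(X_t)` at the terminal time is what forces the
path to be frozen at a fixed `t`. -/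
theorem law_freeze [LocallyCompactSpace S] {I : E S → E S} {v : E S → ℝ}
    (hIP : InversionProperty Z I h v) {x : E S} (hx : I x ∈ inner S) (t : ℝ≥0)
    {Λ : Set (ℝ≥0 → E S)} (hΛ : MeasurableSet Λ) :
    ∫⁻ ω in {ω | freeze t (fun q => Z.X q ω) ∈ Λ}, (inner S).indicator h (Z.X t ω) ∂(Z.P (I x)) =
      h (I x) * Z.P x ({ω | freeze t (Z.turned I v ω) ∈ Λ} ∩ {ω | (t : ℝ≥0∞) < Z.clock v ∞ ω}) := by
  classical
  have hk := hIP.excessive.measurable_indicator_X t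
  have hfX : Measurable fun ω => freeze t (fun q => Z.X q ω) :=
    measurable_pi_lambda _ fun q => Z.measurable_X _
  have hfY : Measurable fun ω => freeze t (Z.turned I v ω) :=
    measurable_pi_lambda _ fun q =>
      (measurable_pi_apply _).comp (measurable_turned hIP.measurable hIP.v_continuous hIP.v_pos)
  have halive : MeasurableSet {ω | (t : ℝ≥0∞) < Z.clock v ∞ ω} :=
    measurableSet_lt measurable_const (Z.measurable_clock hIP.v_continuous hIP.v_pos _)
  let ν₁ := ((Z.P (I x)).withDensity fun ω => (inner S).indicator h (Z.X t ω)).map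
    fun ω => freeze t (fun q => Z.X q ω)
  let ν₂ := (h (I x) • (Z.P x).restrict {ω | (t : ℝ≥0∞) < Z.clock v ∞ ω}).map
    fun ω => freeze t (Z.turned I v ω)
  have e1 : ∀ Λ, MeasurableSet Λ → ν₁ Λ = ∫⁻ ω in {ω | freeze t (fun q => Z.X q ω) ∈ Λ},
      (inner S).indicator h (Z.X t ω) ∂(Z.P (I x)) := fun Λ hΛ => by
    simp only [ν₁]
    rw [Measure.map_apply hfX hΛ, withDensity_apply _ (hfX hΛ)]
    rfl
  have e2 : ∀ Λ, MeasurableSet Λ → ν₂ Λ = h (I x) *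
      Z.P x ({ω | freeze t (Z.turned I v ω) ∈ Λ} ∩ {ω | (t : ℝ≥0∞) < Z.clock v ∞ ω}) :=
    fun Λ hΛ => by
      simp only [ν₂]
      rw [Measure.map_apply hfY hΛ, Measure.smul_apply, smul_eq_mul,
        Measure.restrict_apply (hfY hΛ)]
      rfl
  have key : ∀ Λ ∈ squareCylinders fun _ : ℝ≥0 => {B : Set (E S) | MeasurableSet B},
      ν₁ Λ = ν₂ Λ := by
    rintro Λ ⟨s, B, hB, rfl⟩
    have hB : ∀ q, MeasurableSet (B q) := fun q => hB q (Set.mem_univ q)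
    have hms : MeasurableSet ((s : Set ℝ≥0).pi B) :=
      MeasurableSet.pi s.countable_toSet fun q _ => hB q
    rw [e1 _ hms, e2 _ hms]
    -- Freezing collapses all times `q ≥ t` to `t`, so one time may carry several constraints, which
    -- are intersected.
    let B' : ℝ≥0 → Set (E S) := fun p => ⋂ q ∈ s.filter fun q => min q t = p, B q
    have hB' : ∀ p, MeasurableSet (B' p) := fun p =>
      Finset.measurableSet_biInter _ fun q _ => hB q
    obtain ⟨l, hl1, hl2, hl3⟩ := exists_list_fddEvent (t := t) hB' (s.image fun q => min q t) 0
      zero_le fun q hq => by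
        obtain ⟨r, -, rfl⟩ := Finset.mem_image.1 hq
        exact ⟨zero_le, min_le_right _ _⟩
    have hcyl : ∀ w : ℝ≥0 → E S, freeze t w ∈ (s : Set ℝ≥0).pi B ↔
        ∀ q ∈ insert t (s.image fun q => min q t), w q ∈ B' q := by
      intro w
      constructor
      · intro hw p _
        simp only [B', Set.mem_iInter, Finset.mem_filter]
        rintro q ⟨hq, rfl⟩
        exact hw q hq
      · intro hw q hq
        have := hw (min q t) (Finset.mem_insert_of_mem (Finset.mem_image_of_mem _ hq))
        simp only [B', Set.mem_iInter, Finset.mem_filter] at this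
        exact this q ⟨hq, rfl⟩
    have hle : ∀ q ∈ insert t (s.image fun q => min q t), q ≤ t := by
      intro q hq
      rcases Finset.mem_insert.1 hq with rfl | hq
      · exact le_rfl
      · obtain ⟨r, -, rfl⟩ := Finset.mem_image.1 hq
        exact min_le_right _ _
    have hY : {ω | freeze t (Z.turned I v ω) ∈ (s : Set ℝ≥0).pi B} ∩
        {ω | (t : ℝ≥0∞) < Z.clock v ∞ ω} = fddEvent (Z.inverted I v) 0 l := by
      rw [hl3]
      ext ω
      simp only [Set.mem_inter_iff, Set.mem_ofPred_eq, hcyl, exists_inverted_iff]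
      constructor
      · rintro ⟨h1, h2⟩ q hq
        exact ⟨h1 q hq, lt_of_le_of_lt (by exact_mod_cast hle q hq) h2⟩
      · intro h1
        exact ⟨fun q hq => (h1 q hq).1, (h1 t (Finset.mem_insert_self _ _)).2⟩
    have hX : fddEvent Z.killedPath 0 l =
        Z.X t ⁻¹' inner S ∩ {ω | freeze t (fun q => Z.X q ω) ∈ (s : Set ℝ≥0).pi B} := by
      rw [hl3]
      ext ω
      simp only [Set.mem_inter_iff, Set.mem_ofPred_eq, hcyl, exists_killedPath_iff,
        Set.mem_preimage]
      constructor
      · intro h1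
        exact ⟨(h1 t (Finset.mem_insert_self _ _)).2, fun q hq => (h1 q hq).1⟩
      · rintro ⟨h1, h2⟩ q hq
        refine ⟨h2 q hq, by_contra fun hn => ?_⟩
        rw [Z.absorbed ω q t (hle q hq) hn] at h1
        exact hn h1
    have hms' : MeasurableSet (Z.X t ⁻¹' inner S) :=
      (isOpen_inner S).measurableSet.preimage (Z.measurable_X t)
    rw [hY, law_inverted hIP hx l hl1, hX]
    rw [zero_add] at hl2
    rw [hl2, ← Measure.restrict_restrict hms', ← lintegral_indicator hms']
    refine lintegral_congr fun ω => ?_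
    by_cases h2 : Z.X t ω ∈ inner S <;> simp [Set.indicator, h2]
  have huniv : Set.univ ∈ squareCylinders fun _ : ℝ≥0 => {B : Set (E S) | MeasurableSet B} :=
    ⟨∅, fun _ => Set.univ, fun _ _ => (MeasurableSet.univ : MeasurableSet (Set.univ : Set (E S))), by simp⟩
  have hfin : IsFiniteMeasure ν₁ := by
    refine ⟨?_⟩
    rw [e1 _ MeasurableSet.univ]
    simp only [Set.mem_univ]
    refine (setLIntegral_le_lintegral _ _).trans_lt
      ((hIP.excessive.lintegral_indicator_le (I x) t).trans_lt ?_)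
    rw [Set.indicator_of_mem hx]
    exact hIP.h_lt_top _ hx
  have := ext_of_generate_finite (μ := ν₁) (ν := ν₂) _ generateFrom_squareCylinders.symm
    (isPiSystem_squareCylinders (fun _ => MeasurableSpace.isPiSystem_measurableSet) (by simp))
    key (key _ huniv)
  rw [← e1 _ hΛ, ← e2 _ hΛ, this]

end Transfer

end StandardProcess

/-- The paths which escape during `[t - ε, t)`, into `⋃ G`. -/
def escapeWindow {F : Type*} (K G : ℕ → Set F) (ε t : ℝ≥0) : Set (ℝ≥0 → F) :=
  {w | escape K w < t ∧ (t : ℝ≥0∞) ≤ escape K w + ε ∧ w ∈ escapeIn K G}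

/-- The condition `escape K w < t` confines the remaining conditions to the path strictly before
`t`, so `law_freeze` applies to the window. -/
theorem freeze_mem_escapeWindow {F : Type*} (K G : ℕ → Set F) (ε t : ℝ≥0) (w : ℝ≥0 → F) :
    freeze t w ∈ escapeWindow K G ε t ↔ w ∈ escapeWindow K G ε t := by
  have h := freeze_agree t w
  constructor
  · rintro ⟨h1, h2, h3⟩
    have h4 := escape_congr h h1
    exact ⟨by rwa [h4], by rwa [h4], (mem_escapeIn_congr h h1).1 h3⟩
  · rintro ⟨h1, h2, h3⟩
    have h5 := (escape_lt_congr h).2 h1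
    have h4 := escape_congr h h5
    exact ⟨h5, by rwa [← h4], (mem_escapeIn_congr h h5).2 h3⟩

theorem measurableSet_escapeWindow {F : Type*} [MeasurableSpace F] {K G : ℕ → Set F}
    (hK : ∀ m, MeasurableSet (K m)) (hG : ∀ m, MeasurableSet (G m)) (ε t : ℝ≥0) :
    MeasurableSet (escapeWindow K G ε t) :=
  (measurableSet_lt (measurable_escape hK) measurable_const).inter
    ((measurableSet_le measurable_const ((measurable_escape hK).add_const _)).inter
      (measurableSet_escapeIn hK hG))

/-! ### From fixed times to the escape time -/

namespace StandardProcess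

variable {n : ℕ} {S : Set (EuclideanSpace ℝ (Fin n))} {Ω : Type*} [m₀ : MeasurableSpace Ω]
  {Z : StandardProcess S Ω}

theorem measurable_path (Z : StandardProcess S Ω) : Measurable fun ω q => Z.X q ω :=
  measurable_pi_lambda _ fun q => Z.measurable_X q

theorem measurable_freeze_path (Z : StandardProcess S Ω) (t : ℝ≥0) :
    Measurable[Z.𝓕 t] fun ω => freeze t fun q => Z.X q ω :=
  @measurable_pi_lambda Ω ℝ≥0 (fun _ => E S) (Z.𝓕 t) _ _ fun q =>
    (Z.adapted (min q t)).mono (Z.𝓕.mono (min_le_right _ _)) le_rfl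

theorem isAugStopping_escape (x : E S) {K : ℕ → Set (E S)} (hK : ∀ m, MeasurableSet (K m)) :
    IsAugStopping (Z.P x) Z.𝓕 fun ω => escape K fun q => Z.X q ω := by
  intro t
  refine ⟨_, ?_, ae_eq_refl _⟩
  have : {ω | escape K (fun q => Z.X q ω) < t} =
      (fun ω => freeze t fun q => Z.X q ω) ⁻¹' {w | escape K w < t} := by
    ext ω
    exact (escape_lt_congr (freeze_agree t _)).symm
  rw [this]
  exact Z.measurable_freeze_path t (measurableSet_lt (measurable_escape hK) measurable_const)

theorem beforeStopping_escape (x : E S) {K G : ℕ → Set (E S)} (hK : ∀ m, MeasurableSet (K m))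
    (hG : ∀ m, MeasurableSet (G m)) :
    BeforeStopping (Z.P x) Z.𝓕 (fun ω => escape K fun q => Z.X q ω)
      {ω | (fun q => Z.X q ω) ∈ escapeIn K G} := by
  intro t
  refine ⟨_, ?_, ae_eq_refl _⟩
  have : {ω | (fun q => Z.X q ω) ∈ escapeIn K G} ∩ {ω | escape K (fun q => Z.X q ω) < t} =
      (fun ω => freeze t fun q => Z.X q ω) ⁻¹' (escapeIn K G ∩ {w | escape K w < t}) := by
    ext ω
    have h1 := escape_lt_congr (K := K) (freeze_agree t fun q => Z.X q ω)
    simp only [Set.mem_inter_iff, Set.mem_ofPred_eq, Set.mem_preimage]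
    rw [h1, and_congr_left_iff]
    exact fun h2 => (mem_escapeIn_congr (freeze_agree t fun q => Z.X q ω) (h1.2 h2)).symm
  rw [this]
  exact Z.measurable_freeze_path t ((measurableSet_escapeIn hK hG).inter
    (measurableSet_lt (measurable_escape hK) measurable_const))

/-- By Fubini, integrate first over `t`. On `R`, the admissible times are those of `(e, e + ε]`
below `L`: none if `L ≤ e`, length at most `ε` in general, and exactly `ε` when `e + ε < L`. -/
theorem lintegral_window_le (μ : Measure Ω) [SFinite μ] {Y : Ω → ℝ≥0 → E S} (hY : Measurable Y)
    {L : Ω → ℝ≥0∞} (hL : Measurable L) {K G : ℕ → Set (E S)} (hK : ∀ m, MeasurableSet (K m))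
    (hG : ∀ m, MeasurableSet (G m)) (ε : ℝ≥0) :
    ∫⁻ t : ℝ, μ ({ω | Y ω ∈ escapeWindow K G ε t.toNNReal} ∩ {ω | (t.toNNReal : ℝ≥0∞) < L ω}) ≤
        ε * μ ({ω | Y ω ∈ escapeIn K G} ∩ {ω | escape K (Y ω) < L ω}) ∧
      ε * μ ({ω | Y ω ∈ escapeIn K G} ∩ {ω | escape K (Y ω) + ε < L ω}) ≤
    ∫⁻ t : ℝ, μ ({ω | Y ω ∈ escapeWindow K G ε t.toNNReal} ∩ {ω | (t.toNNReal : ℝ≥0∞) < L ω}) := by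
  set e : Ω → ℝ≥0∞ := fun ω => escape K (Y ω) with he_def
  set R : Set Ω := {ω | Y ω ∈ escapeIn K G} with hR_def
  have he : Measurable e := (measurable_escape hK).comp hY
  have hR : MeasurableSet R := hY (measurableSet_escapeIn hK hG)
  let W : Set (ℝ × Ω) := {p | (e p.2 < ENNReal.ofReal p.1 ∧ ENNReal.ofReal p.1 ≤ e p.2 + ε ∧
    p.2 ∈ R) ∧ ENNReal.ofReal p.1 < L p.2}
  have hW : MeasurableSet W :=
    ((measurableSet_lt (he.comp measurable_snd)
      (ENNReal.measurable_ofReal.comp measurable_fst)).inter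
      ((measurableSet_le (ENNReal.measurable_ofReal.comp measurable_fst)
        ((he.comp measurable_snd).add_const _)).inter (hR.preimage measurable_snd))).inter
      (measurableSet_lt (ENNReal.measurable_ofReal.comp measurable_fst) (hL.comp measurable_snd))
  have h1 : ∫⁻ t : ℝ, μ ({ω | Y ω ∈ escapeWindow K G ε t.toNNReal} ∩
      {ω | (t.toNNReal : ℝ≥0∞) < L ω}) = ∫⁻ ω, volume ((fun t => (t, ω)) ⁻¹' W) ∂μ := by
    rw [← Measure.prod_apply_symm hW, Measure.prod_apply hW]
    rfl
  rw [h1]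
  have hC0 : MeasurableSet (R ∩ {ω | e ω < L ω}) := hR.inter (measurableSet_lt he hL)
  have hC1 : MeasurableSet (R ∩ {ω | e ω + ε < L ω}) :=
    hR.inter (measurableSet_lt (he.add_const _) hL)
  have hvol : ∀ a : ℝ≥0, volume (Set.Ioc (a : ℝ) (a + ε)) = ε := fun a => by
    rw [Real.volume_Ioc, add_sub_cancel_left, ENNReal.ofReal_coe_nnreal]
  rw [← lintegral_indicator_const hC0, ← lintegral_indicator_const hC1]
  constructor
  · refine lintegral_mono fun ω => ?_
    by_cases hω : ω ∈ R ∩ {ω | e ω < L ω}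
    · rw [Set.indicator_of_mem hω]
      obtain ⟨a, ha⟩ : ∃ a : ℝ≥0, (a : ℝ≥0∞) = e ω :=
        ⟨_, ENNReal.coe_toNNReal (show e ω < L ω from hω.2).ne_top⟩
      rw [← hvol a]
      refine measure_mono fun t ht => ?_
      obtain ⟨⟨h2, h3, -⟩, -⟩ := ht
      simp only [← ha] at h2 h3
      rw [← ENNReal.ofReal_coe_nnreal, ENNReal.ofReal_lt_ofReal_iff_of_nonneg a.coe_nonneg] at h2
      rw [← ENNReal.coe_add, ← ENNReal.ofReal_coe_nnreal,
        ENNReal.ofReal_le_ofReal_iff (by positivity)] at h3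
      exact ⟨h2, by exact_mod_cast h3⟩
    · have : (fun t => (t, ω)) ⁻¹' W = ∅ := by
        rw [Set.eq_empty_iff_forall_notMem]
        rintro t ⟨⟨h2, -, h4⟩, h5⟩
        exact hω ⟨h4, h2.trans h5⟩
      rw [this, measure_empty]
      exact zero_le
  · refine lintegral_mono fun ω => ?_
    by_cases hω : ω ∈ R ∩ {ω | e ω + ε < L ω}
    · rw [Set.indicator_of_mem hω]
      have hlt : e ω + ε < L ω := hω.2
      obtain ⟨a, ha⟩ : ∃ a : ℝ≥0, (a : ℝ≥0∞) = e ω :=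
        ⟨_, ENNReal.coe_toNNReal (le_self_add.trans_lt hlt).ne_top⟩
      rw [← hvol a]
      refine measure_mono fun t ht => ?_
      have h3 : ENNReal.ofReal t ≤ e ω + ε := by
        rw [← ha, ← ENNReal.coe_add, ← ENNReal.ofReal_coe_nnreal]
        exact ENNReal.ofReal_le_ofReal (by push_cast; exact ht.2)
      refine ⟨⟨?_, h3, hω.1⟩, h3.trans_lt hlt⟩
      simp only [← ha]
      rw [← ENNReal.ofReal_coe_nnreal, ENNReal.ofReal_lt_ofReal_iff_of_nonneg a.coe_nonneg]
      exact ht.1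
    · rw [Set.indicator_of_notMem hω]
      exact zero_le

section Core

variable [LocallyCompactSpace S] {I : E S → E S} {h : E S → ℝ≥0∞} {v : E S → ℝ}

/-- Fubini and the substitution `t = e + s` turn the window into `0 < s ≤ ε`; the strong Markov
property at `e` then restarts the process at `X_e`. -/
theorem lintegral_window_path (x : E S) {K G : ℕ → Set (E S)} (hK : ∀ m, MeasurableSet (K m))
    (hG : ∀ m, MeasurableSet (G m)) {k : E S → ℝ≥0∞} (hk : Measurable k) (ε : ℝ≥0) :
    ∫⁻ t : ℝ, ∫⁻ ω in {ω | (fun q => Z.X q ω) ∈ escapeWindow K G ε t.toNNReal},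
        k (Z.X t.toNNReal ω) ∂(Z.P x) =
      ∫⁻ s in Set.Ioc (0 : ℝ) ε, ∫⁻ ω in {ω | (fun q => Z.X q ω) ∈ escapeIn K G} ∩
        {ω | escape K (fun q => Z.X q ω) < ∞},
        ∫⁻ η, k (Z.X s.toNNReal η) ∂(Z.P (Z.X (escape K fun q => Z.X q ω).toNNReal ω))
          ∂(Z.P x) := by
  set e : Ω → ℝ≥0∞ := fun ω => escape K fun q => Z.X q ω with he_def
  set R : Set Ω := {ω | (fun q => Z.X q ω) ∈ escapeIn K G} with hR_def
  have he : Measurable e := (measurable_escape hK).comp Z.measurable_path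
  have hR : MeasurableSet R := Z.measurable_path (measurableSet_escapeIn hK hG)
  have hRe : MeasurableSet (R ∩ {ω | e ω < ∞}) := hR.inter (he measurableSet_Iio)
  have hXe : ∀ t, Measurable fun ω => Z.X ((e ω).toNNReal + t) ω := fun t =>
    Z.measurable_uncurry.comp ((he.ennreal_toNNReal.add_const t).prodMk measurable_id)
  have hsm : ∀ s : ℝ, ∫⁻ ω in R ∩ {ω | e ω < ∞},
      ∫⁻ η, k (Z.X s.toNNReal η) ∂(Z.P (Z.X (e ω).toNNReal ω)) ∂(Z.P x) =
      ∫⁻ ω in R ∩ {ω | e ω < ∞}, k (Z.X ((e ω).toNNReal + s.toNNReal) ω) ∂(Z.P x) := fun s =>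
    (Z.strong_markov_lintegral he hXe hR (isAugStopping_escape x hK)
      (beforeStopping_escape x hK hG) s.toNNReal hk).symm
  refine Eq.trans ?_ (lintegral_congr fun s => hsm s).symm
  let W : Set (ℝ × Ω) := {p | e p.2 < ENNReal.ofReal p.1 ∧ ENNReal.ofReal p.1 ≤ e p.2 + ε ∧ p.2 ∈ R}
  have hW : MeasurableSet W :=
    (measurableSet_lt (he.comp measurable_snd) (ENNReal.measurable_ofReal.comp measurable_fst)).inter
      ((measurableSet_le (ENNReal.measurable_ofReal.comp measurable_fst)
        ((he.comp measurable_snd).add_const _)).inter (hR.preimage measurable_snd))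
  have hkX : Measurable fun p : ℝ × Ω => k (Z.X p.1.toNNReal p.2) :=
    hk.comp (Z.measurable_uncurry.comp
      ((measurable_real_toNNReal.comp measurable_fst).prodMk measurable_snd))
  have hkX' : Measurable fun p : ℝ × Ω => k (Z.X ((e p.2).toNNReal + p.1.toNNReal) p.2) :=
    hk.comp (Z.measurable_uncurry.comp
      (((he.comp measurable_snd).ennreal_toNNReal.add
        (measurable_real_toNNReal.comp measurable_fst)).prodMk measurable_snd))
  have h1 : ∀ t : ℝ, ∫⁻ ω in {ω | (fun q => Z.X q ω) ∈ escapeWindow K G ε t.toNNReal},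
        k (Z.X t.toNNReal ω) ∂(Z.P x) =
      ∫⁻ ω, W.indicator (fun p => k (Z.X p.1.toNNReal p.2)) (t, ω) ∂(Z.P x) := fun t => by
    have hm : MeasurableSet {ω | (fun q => Z.X q ω) ∈ escapeWindow K G ε t.toNNReal} :=
      Z.measurable_path (measurableSet_escapeWindow hK hG ε t.toNNReal)
    rw [← lintegral_indicator hm]
    rfl
  simp_rw [h1]
  rw [lintegral_lintegral_swap
      (f := fun t ω => W.indicator (fun p => k (Z.X p.1.toNNReal p.2)) (t, ω))
      (hkX.indicator hW).aemeasurable,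
    lintegral_lintegral_swap (f := fun (s : ℝ) ω => k (Z.X ((e ω).toNNReal + s.toNNReal) ω))
      hkX'.aemeasurable, ← lintegral_indicator hRe]
  refine lintegral_congr fun ω => ?_
  by_cases hω : ω ∈ R ∩ {ω | e ω < ∞}
  · rw [Set.indicator_of_mem hω]
    obtain ⟨a, ha⟩ : ∃ a : ℝ≥0, (a : ℝ≥0∞) = e ω := ⟨_, ENNReal.coe_toNNReal hω.2.ne⟩
    rw [← lintegral_add_left_eq_self (μ := volume) _ (a : ℝ),
      ← lintegral_indicator measurableSet_Ioc]
    refine lintegral_congr fun s => ?_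
    by_cases hs : s ∈ Set.Ioc (0 : ℝ) ε
    · have hadd : ((a : ℝ) + s).toNNReal = a + s.toNNReal := by
        rw [Real.toNNReal_add a.coe_nonneg hs.1.le, Real.toNNReal_coe]
      have hmem : ((a : ℝ) + s, ω) ∈ W := by
        refine ⟨?_, ?_, hω.1⟩
        · simp only [← ha]
          rw [← ENNReal.ofReal_coe_nnreal, ENNReal.ofReal_lt_ofReal_iff_of_nonneg a.coe_nonneg]
          linarith [hs.1]
        · simp only [← ha]
          rw [← ENNReal.coe_add, ← ENNReal.ofReal_coe_nnreal]
          exact ENNReal.ofReal_le_ofReal (by push_cast; linarith [hs.2])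
      rw [Set.indicator_of_mem hmem, Set.indicator_of_mem hs]
      simp only [hadd, ← ha, ENNReal.toNNReal_coe]
    · rw [Set.indicator_of_notMem hs, Set.indicator_of_notMem]
      rintro ⟨h2, h3, -⟩
      simp only [← ha] at h2 h3
      rw [← ENNReal.ofReal_coe_nnreal, ENNReal.ofReal_lt_ofReal_iff_of_nonneg a.coe_nonneg] at h2
      rw [← ENNReal.coe_add, ← ENNReal.ofReal_coe_nnreal,
        ENNReal.ofReal_le_ofReal_iff (by positivity)] at h3
      push_cast at h3
      exact hs ⟨by linarith, by linarith⟩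
  · rw [Set.indicator_of_notMem hω]
    refine (lintegral_congr fun t => ?_).trans lintegral_zero
    refine Set.indicator_of_notMem (fun h2 => hω ⟨h2.2.2, ?_⟩) _
    exact h2.1.trans ENNReal.ofReal_lt_top

/-- The law of `X` at an escape time, weighted by `h`, is the law of the inverted process. -/
theorem law_escape (hIP : InversionProperty Z I h v) {x : E S} (hx : I x ∈ inner S)
    {K G : ℕ → Set (E S)} (hK : ∀ m, MeasurableSet (K m)) (hG : ∀ m, MeasurableSet (G m)) :
    ∫⁻ ω in {ω | (fun q => Z.X q ω) ∈ escapeIn K G} ∩ {ω | escape K (fun q => Z.X q ω) < ∞},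
        (inner S).indicator h (Z.X (escape K fun q => Z.X q ω).toNNReal ω) ∂(Z.P (I x)) =
      h (I x) * Z.P x ({ω | Z.turned I v ω ∈ escapeIn K G} ∩
        {ω | escape K (Z.turned I v ω) < Z.clock v ∞ ω}) := by
  have hh := hIP.excessive
  have hk := hh.measurable_indicator
  have hY := measurable_turned hIP.measurable hIP.v_continuous hIP.v_pos (Z := Z)
  have hL := Z.measurable_clock hIP.v_continuous hIP.v_pos ∞
  have hhx := hIP.h_lt_top _ hx
  set e : Ω → ℝ≥0∞ := fun ω => escape K fun q => Z.X q ω with he_def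
  set R : Set Ω := {ω | (fun q => Z.X q ω) ∈ escapeIn K G} with hR_def
  have he : Measurable e := (measurable_escape hK).comp Z.measurable_path
  have hXe : Measurable fun ω => Z.X (e ω).toNNReal ω :=
    Z.measurable_uncurry.comp (he.ennreal_toNNReal.prodMk measurable_id)
  let a : ℝ≥0 → ℝ≥0∞ := fun s => ∫⁻ ω in R ∩ {ω | e ω < ∞},
    ∫⁻ η, (inner S).indicator h (Z.X s η) ∂(Z.P (Z.X (e ω).toNNReal ω)) ∂(Z.P (I x))
  let c : ℝ≥0 → ℝ≥0∞ := fun s => Z.P x ({ω | Z.turned I v ω ∈ escapeIn K G} ∩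
        {ω | escape K (Z.turned I v ω) + s < Z.clock v ∞ ω})
  set a0 := ∫⁻ ω in R ∩ {ω | e ω < ∞},
    (inner S).indicator h (Z.X (e ω).toNNReal ω) ∂(Z.P (I x)) with ha0
  set c0 := Z.P x ({ω | Z.turned I v ω ∈ escapeIn K G} ∩
        {ω | escape K (Z.turned I v ω) < Z.clock v ∞ ω}) with hc0
  have ha_anti : Antitone a := fun s t hst =>
    lintegral_mono fun ω => hh.antitone_lintegral_indicator _ hst
  have ha_le : ∀ s, a s ≤ a0 := fun s => lintegral_mono fun ω => hh.lintegral_indicator_le _ s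
  -- The averaged identity is squeezed between its end values: `a` decreases because `h`, cut off
  -- outside `E°`, is supermedian, so the integral of `a` over `(0, ε]` lies between `ε * a ε` and
  -- `ε * a0`, while the other side lies between `ε * h (I x) * c ε` and `ε * h (I x) * c0`.
  have key : ∀ ε : ℝ≥0, 0 < ε → a ε ≤ h (I x) * c0 ∧ h (I x) * c ε ≤ a0 := by
    intro ε hε
    have h1 := lintegral_window_path (Z := Z) (I x) hK hG hk ε
    have h2 : ∀ t : ℝ, ∫⁻ ω in {ω | (fun q => Z.X q ω) ∈ escapeWindow K G ε t.toNNReal},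
        (inner S).indicator h (Z.X t.toNNReal ω) ∂(Z.P (I x)) =
        h (I x) * Z.P x ({ω | Z.turned I v ω ∈ escapeWindow K G ε t.toNNReal} ∩
          {ω | (t.toNNReal : ℝ≥0∞) < Z.clock v ∞ ω}) := fun t => by
      have := law_freeze hIP hx t.toNNReal (measurableSet_escapeWindow hK hG ε t.toNNReal)
      simpa only [freeze_mem_escapeWindow] using this
    simp_rw [h2] at h1
    rw [lintegral_const_mul' _ _ hhx.ne] at h1
    obtain ⟨h3, h4⟩ := lintegral_window_le (Z.P x) hY hL hK hG ε
    have hvol : volume (Set.Ioc (0 : ℝ) ε) = ε := by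
      rw [Real.volume_Ioc, sub_zero, ENNReal.ofReal_coe_nnreal]
    have hε0 : (ε : ℝ≥0∞) ≠ 0 := by exact_mod_cast hε.ne'
    have h5 : ∫⁻ s in Set.Ioc (0 : ℝ) ε, a s.toNNReal ≤ ε * a0 := by
      rw [← hvol, mul_comm, ← setLIntegral_const]
      exact lintegral_mono fun s => ha_le _
    have h6 : ε * a ε ≤ ∫⁻ s in Set.Ioc (0 : ℝ) ε, a s.toNNReal := by
      rw [← hvol, mul_comm, ← setLIntegral_const]
      refine setLIntegral_mono' measurableSet_Ioc fun s hs => ha_anti ?_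
      rw [Real.toNNReal_le_iff_le_coe]
      exact hs.2
    constructor
    · rw [← ENNReal.mul_le_mul_iff_right hε0 ENNReal.coe_ne_top]
      refine h6.trans (h1.symm.le.trans ?_)
      rw [mul_left_comm]
      gcongr
    · rw [← ENNReal.mul_le_mul_iff_right hε0 ENNReal.coe_ne_top]
      refine le_trans ?_ (h1.le.trans h5)
      rw [mul_left_comm]
      gcongr
  let ε : ℕ → ℝ≥0 := fun n => 1 / ((n : ℝ≥0) + 1)
  have hεpos : ∀ n, 0 < ε n := fun n => by simp only [ε]; positivity
  have hε : Tendsto ε atTop (𝓝 0) := tendsto_one_div_add_atTop_nhds_zero_nat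
  have hε_anti : Antitone ε := fun m n hmn => by simp only [ε]; gcongr
  refine le_antisymm ?_ ?_
  -- Excessivity gives pointwise convergence of the inner mean to the killed weight; Fatou's lemma
  -- gives `a0 ≤ liminf a (ε n)`.
  · have hlim : ∀ y, Tendsto (fun n => ∫⁻ η, (inner S).indicator h (Z.X (ε n) η) ∂(Z.P y)) atTop
        (𝓝 ((inner S).indicator h y)) := fun y => by
      by_cases hy : y ∈ inner S
      · rw [Set.indicator_of_mem hy]
        exact hh.tendsto_lintegral_indicator hy (hIP.h_lt_top y hy)
      · refine tendsto_of_tendsto_of_tendsto_of_le_of_le tendsto_const_nhds tendsto_const_nhds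
          (fun n => ?_) (fun n => hh.lintegral_indicator_le y (ε n))
        rw [Set.indicator_of_notMem hy]
        exact zero_le
    calc a0 = ∫⁻ ω in R ∩ {ω | e ω < ∞}, liminf (fun n => ∫⁻ η, (inner S).indicator h
            (Z.X (ε n) η) ∂(Z.P (Z.X (e ω).toNNReal ω))) atTop ∂(Z.P (I x)) :=
          lintegral_congr fun ω => (hlim _).liminf_eq.symm
      _ ≤ liminf (fun n => a (ε n)) atTop :=
          lintegral_liminf_le fun n => (Z.measurable_transition_lintegral hk (ε n)).comp hXe
      _ ≤ liminf (fun _ : ℕ => h (I x) * c0) atTop :=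
          liminf_le_liminf (Eventually.of_forall fun n => (key _ (hεpos n)).1)
      _ = h (I x) * c0 := liminf_const _
  -- The strict inequality `e < A_ζ` leaves room for some `ε n`, so continuity from below applies.
  · have hc : Tendsto (fun n => c (ε n)) atTop (𝓝 c0) := by
      have hU : ({ω | Z.turned I v ω ∈ escapeIn K G} ∩
          {ω | escape K (Z.turned I v ω) < Z.clock v ∞ ω}) =
          ⋃ n, {ω | Z.turned I v ω ∈ escapeIn K G} ∩
            {ω | escape K (Z.turned I v ω) + ε n < Z.clock v ∞ ω} := by
        rw [← Set.inter_iUnion]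
        congr 1
        ext ω
        simp only [Set.mem_ofPred_eq, Set.mem_iUnion]
        constructor
        · intro hω
          have : Tendsto (fun n => escape K (Z.turned I v ω) + (ε n : ℝ≥0∞)) atTop
              (𝓝 (escape K (Z.turned I v ω) + ((0 : ℝ≥0) : ℝ≥0∞))) :=
            tendsto_const_nhds.add (ENNReal.tendsto_coe.2 hε)
          rw [ENNReal.coe_zero, add_zero] at this
          exact (this.eventually (gt_mem_nhds hω)).exists
        · rintro ⟨n, hn⟩
          exact le_self_add.trans_lt hn
      rw [hc0, hU]
      refine tendsto_measure_iUnion_atTop fun m n hmn => Set.inter_subset_inter_right _ fun ω hω => ?_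
      have hω : escape K (Z.turned I v ω) + ε m < Z.clock v ∞ ω := hω
      refine lt_of_le_of_lt ?_ hω
      gcongr
      exact hε_anti hmn
    exact le_of_tendsto' (ENNReal.Tendsto.const_mul hc (Or.inr hhx.ne)) fun n =>
      (key _ (hεpos n)).2

end Core

end StandardProcess

theorem Exhausts.image {F : Type*} [TopologicalSpace F] {K : ℕ → Set F} {U : Set F} {I : F → F}
    (hK : Exhausts K U) (hc : ContinuousOn I U)
    (ho : ∀ O : Set F, IsOpen O → O ⊆ U → IsOpen (I '' O)) :
    Exhausts (fun m => I '' K m) (I '' U) where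
  compact m := (hK.compact m).image_of_continuousOn (hc.mono (hK.subset m))
  mono _ _ hab := Set.image_mono (hK.mono hab)
  subset m := Set.image_mono (hK.subset m)
  cover := by
    rintro _ ⟨z, hz, rfl⟩
    obtain ⟨m, hm⟩ := hK.cover z hz
    exact ⟨m, mem_interior.2 ⟨I '' interior (K m), Set.image_mono interior_subset,
      ho _ isOpen_interior (interior_subset.trans (hK.subset m)), ⟨z, hm, rfl⟩⟩⟩

/-! ### Escape of the inverted, time-changed path -/

namespace StandardProcess

variable {n : ℕ} {S : Set (EuclideanSpace ℝ (Fin n))} {Ω : Type*} [m₀ : MeasurableSpace Ω]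
  {Z : StandardProcess S Ω}

section TimeChange

variable {I : E S → E S} {v : E S → ℝ} {ω : Ω}

theorem invClock_eq (v : E S → ℝ) (q : ℝ≥0) (ω : Ω) : Z.invClock v q ω =
    sInf {t : ℝ≥0 | (q : ℝ≥0∞) < ∫⁻ r in Set.Ico (0 : ℝ) t, Z.rate v ω r} := by
  simp only [invClock, clock_coe]

theorem exists_time_of_lt_clock (hφ : IsClockRate (Z.rate v ω) (Z.lifetime ω)) {q : ℝ≥0}
    (hq : (q : ℝ≥0∞) < Z.clock v ∞ ω) : ((Z.invClock v q ω : ℝ≥0) : ℝ≥0∞) < Z.lifetime ω ∧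
      Z.clock v (Z.invClock v q ω) ω = q := by
  rw [clock_top] at hq
  obtain ⟨s, hs, hsq⟩ := hφ.exists_eq hq
  rw [invClock_eq, hφ.sInf_eq hs hsq, clock_coe]
  exact ⟨hs, hsq⟩

theorem exists_clock_of_lt_lifetime (hφ : IsClockRate (Z.rate v ω) (Z.lifetime ω)) {s : ℝ≥0}
    (hs : (s : ℝ≥0∞) < Z.lifetime ω) : ∃ q : ℝ≥0, (q : ℝ≥0∞) < Z.clock v ∞ ω ∧
      Z.clock v s ω = q ∧ Z.invClock v q ω = s := by
  have h1 := hφ.lt_top hs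
  have h2 : ∫⁻ r in Set.Ico (0 : ℝ) s, Z.rate v ω r =
    ((∫⁻ r in Set.Ico (0 : ℝ) s, Z.rate v ω r).toNNReal : ℝ≥0) := (ENNReal.coe_toNNReal h1.ne).symm
  refine ⟨_, ?_, by rw [clock_coe]; exact h2, by rw [invClock_eq]; exact hφ.sInf_eq hs h2⟩
  rw [← h2, clock_top]
  exact hφ.lt_total hs

theorem clock_mono (v : E S → ℝ) (ω : Ω) {s t : ℝ≥0} (hst : s ≤ t) :
    Z.clock v s ω ≤ Z.clock v t ω := by
  rw [clock_coe, clock_coe]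
  exact IsClockRate.mono _ hst

theorem invClock_mono (hφ : IsClockRate (Z.rate v ω) (Z.lifetime ω)) {q q' : ℝ≥0}
    (hq' : (q' : ℝ≥0∞) < Z.clock v ∞ ω) (hqq : q ≤ q') :
    Z.invClock v q ω ≤ Z.invClock v q' ω := by
  have hq : (q : ℝ≥0∞) < Z.clock v ∞ ω := lt_of_le_of_lt (by exact_mod_cast hqq) hq'
  obtain ⟨h1, h2⟩ := exists_time_of_lt_clock hφ hq
  obtain ⟨h3, h4⟩ := exists_time_of_lt_clock hφ hq'
  by_contra! hlt
  have := hφ.strictMono hlt h3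
  rw [← clock_coe, ← clock_coe, h2, h4, ENNReal.coe_lt_coe] at this
  exact absurd this (not_lt.2 hqq)

/-- The clock is strictly increasing before `ζ`: any `u` slightly above `γ_q` has a clock value
above `q`, and `γ` stays below `u` up to that value. -/
theorem tendsto_invClock (hφ : IsClockRate (Z.rate v ω) (Z.lifetime ω)) {q : ℝ≥0}
    (hq : (q : ℝ≥0∞) < Z.clock v ∞ ω) :
    Tendsto (fun r => Z.invClock v r ω) (𝓝[≥] q) (𝓝[≥] (Z.invClock v q ω)) := by
  obtain ⟨h1, h2⟩ := exists_time_of_lt_clock hφ hq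
  obtain ⟨p, hp1, hp2⟩ := ENNReal.lt_iff_exists_nnreal_btwn.1 hq
  have hqp : q < p := by exact_mod_cast hp1
  have hge : ∀ᶠ r in 𝓝[≥] q, Z.invClock v q ω ≤ Z.invClock v r ω := by
    filter_upwards [Ico_mem_nhdsGE hqp] with r hr
    exact invClock_mono hφ (lt_trans (by exact_mod_cast hr.2) hp2) hr.1
  refine tendsto_nhdsWithin_iff.2 ⟨tendsto_order.2 ⟨fun a ha => ?_, fun b hb => ?_⟩, hge⟩
  · exact hge.mono fun r hr => ha.trans_le hr
  · obtain ⟨u, hu1, hu2⟩ := ENNReal.lt_iff_exists_nnreal_btwn.1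
      (lt_min h1 (show (Z.invClock v q ω : ℝ≥0∞) < b by exact_mod_cast hb))
    obtain ⟨hu2, hu3⟩ := lt_min_iff.1 hu2
    obtain ⟨p', hp'1, hp'2, hp'3⟩ := exists_clock_of_lt_lifetime hφ hu2
    have hqp' : q < p' := by
      have := hφ.strictMono (show Z.invClock v q ω < u by exact_mod_cast hu1) h1
      rw [← clock_coe, ← clock_coe, h2, hp'2] at this
      exact_mod_cast this
    filter_upwards [Ico_mem_nhdsGE hqp'] with r hr
    have := invClock_mono hφ hp'1 hr.2.le
    rw [hp'3] at this
    exact this.trans_lt (by exact_mod_cast hu3)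

theorem turned_right_continuous (hφ : IsClockRate (Z.rate v ω) (Z.lifetime ω))
    (hIc : ContinuousOn I (inner S)) {q : ℝ≥0} (hq : (q : ℝ≥0∞) < Z.clock v ∞ ω) :
    ContinuousWithinAt (Z.turned I v ω) (Set.Ici q) q := by
  obtain ⟨h1, -⟩ := exists_time_of_lt_clock hφ hq
  have h2 : ContinuousAt I (Z.X (Z.invClock v q ω) ω) :=
    hIc.continuousAt ((isOpen_inner S).mem_nhds ((Z.mem_inner_iff _ _).2 h1))
  exact h2.tendsto.comp ((Z.right_continuous ω _).tendsto.comp (tendsto_invClock hφ hq))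

/-- The inverse clock maps `[0, q]` onto `[0, γ_q]`, and `I` is injective. -/
theorem forall_turned_iff (hφ : IsClockRate (Z.rate v ω) (Z.lifetime ω))
    (hI : Function.Injective I) {q : ℝ≥0} (hq : (q : ℝ≥0∞) < Z.clock v ∞ ω) (B : Set (E S)) :
    (∀ r ≤ q, Z.turned I v ω r ∈ I '' B) ↔ ∀ r ≤ Z.invClock v q ω, Z.X r ω ∈ B := by
  obtain ⟨h1, h2⟩ := exists_time_of_lt_clock hφ hq
  simp only [turned, hI.mem_set_image]
  constructor
  · intro h r hr
    obtain ⟨p, hp1, hp2, hp3⟩ := exists_clock_of_lt_lifetime hφ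
      (lt_of_le_of_lt (show (r : ℝ≥0∞) ≤ Z.invClock v q ω by exact_mod_cast hr) h1)
    have hpq : p ≤ q := by
      have := Z.clock_mono v ω hr
      rw [hp2, h2] at this
      exact_mod_cast this
    have := h p hpq
    rwa [hp3] at this
  · exact fun h r hr => h _ (invClock_mono hφ hq hr)

/-- A clock time precedes the escape of the turned path exactly when its image under `γ` precedes
the escape of `X`. Hence `A_e` is the escape time of the turned path when `e < ζ`, and its position
there is `I(X_e)`. -/
theorem turned_escape_iff [LocallyCompactSpace S] (hφ : IsClockRate (Z.rate v ω) (Z.lifetime ω))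
    (hI : Function.Injective I) (hIc : ContinuousOn I (inner S)) {U O : Set (E S)}
    {K G : ℕ → Set (E S)} (hU : IsOpen U) (hIU : IsOpen (I '' U)) (hK : Exhausts K U)
    (hIK : Exhausts (fun m => I '' K m) (I '' U)) (hG : Exhausts G O)
    (hcc : ∀ s : ℝ≥0, (s : ℝ≥0∞) < Z.lifetime ω → (∀ r ≤ s, Z.X r ω ∈ U) →
      ∃ m, ∀ r ≤ s, Z.X r ω ∈ K m) :
    (Z.turned I v ω ∈ escapeIn (fun m => I '' K m) G ∧
      escape (fun m => I '' K m) (Z.turned I v ω) < Z.clock v ∞ ω) ↔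
    (escape K (fun q => Z.X q ω) < Z.lifetime ω ∧
      I (Z.X (escape K fun q => Z.X q ω).toNNReal ω) ∈ O) := by
  have hX : ∀ s : ℝ≥0, (s : ℝ≥0∞) < Z.lifetime ω →
      ((s : ℝ≥0∞) < escape K (fun q => Z.X q ω) ↔ ∀ r ≤ s, Z.X r ω ∈ U) := fun s hs =>
    lt_escape_iff hU hK (fun s _ => Z.right_continuous ω s) hcc hs
  have hY : ∀ q : ℝ≥0, (q : ℝ≥0∞) < Z.clock v ∞ ω →
      ((q : ℝ≥0∞) < escape (fun m => I '' K m) (Z.turned I v ω) ↔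
        ((Z.invClock v q ω : ℝ≥0) : ℝ≥0∞) < escape K (fun q => Z.X q ω)) := fun q hq => by
    obtain ⟨h1, -⟩ := exists_time_of_lt_clock hφ hq
    rw [lt_escape_iff hIU hIK (fun s hs => turned_right_continuous hφ hIc hs) (fun s hs h => ?_) hq,
      hX _ h1, forall_turned_iff hφ hI hq]
    rw [forall_turned_iff hφ hI hs] at h
    obtain ⟨m, hm⟩ := hcc _ (exists_time_of_lt_clock hφ hs).1 h
    exact ⟨m, (forall_turned_iff hφ hI hs _).2 hm⟩
  have main : escape K (fun q => Z.X q ω) < Z.lifetime ω →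
      (escape (fun m => I '' K m) (Z.turned I v ω) < Z.clock v ∞ ω ∧
      (Z.turned I v ω ∈ escapeIn (fun m => I '' K m) G ↔
        I (Z.X (escape K fun q => Z.X q ω).toNNReal ω) ∈ O)) := by
    intro hlt
    obtain ⟨a, ha⟩ : ∃ a : ℝ≥0, (a : ℝ≥0∞) = escape K fun q => Z.X q ω :=
      ⟨_, ENNReal.coe_toNNReal hlt.ne_top⟩
    rw [← ha] at hlt hY ⊢
    obtain ⟨q, hq1, hq2, hq3⟩ := exists_clock_of_lt_lifetime hφ hlt
    have hesc : escape (fun m => I '' K m) (Z.turned I v ω) = q := by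
      refine le_antisymm (not_lt.1 fun h => ?_) (not_lt.1 fun h => ?_)
      · rw [hY q hq1, hq3] at h
        exact lt_irrefl _ h
      · obtain ⟨s, hs⟩ : ∃ s : ℝ≥0, (s : ℝ≥0∞) = escape (fun m => I '' K m) (Z.turned I v ω) :=
          ⟨_, ENNReal.coe_toNNReal h.ne_top⟩
        rw [← hs] at h hY
        have hsL := h.trans hq1
        have h3 : a ≤ Z.invClock v s ω := by
          have := mt (hY s hsL).2 (lt_irrefl _)
          exact_mod_cast not_lt.1 this
        have h4 := Z.clock_mono v ω h3
        rw [hq2, (exists_time_of_lt_clock hφ hsL).2] at h4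
        exact absurd h (not_lt.2 h4)
    refine ⟨by rwa [hesc], ?_⟩
    rw [mem_escapeIn_iff hG hesc (turned_right_continuous hφ hIc hq1), turned, hq3,
      ENNReal.toNNReal_coe]
  constructor
  · rintro ⟨h1, h2⟩
    obtain ⟨s, hs⟩ : ∃ s : ℝ≥0, (s : ℝ≥0∞) = escape (fun m => I '' K m) (Z.turned I v ω) :=
      ⟨_, ENNReal.coe_toNNReal h2.ne_top⟩
    have hs2 := h2
    rw [← hs] at hs2
    have h3 := mt (hY s hs2).2 (by rw [hs]; exact lt_irrefl _)
    have h4 := (not_lt.1 h3).trans_lt (exists_time_of_lt_clock hφ hs2).1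
    exact ⟨h4, (main h4).2.1 h1⟩
  · rintro ⟨h1, h2⟩
    exact ⟨(main h1).2.2 h2, (main h1).1⟩

end TimeChange

/-! ### Exit means as means at the escape time -/

section Exit

theorem exitMean_of_notMem_inner {V : Set (E S)} {x : E S} (hx : x ∉ inner S) (hxV : x ∈ V)
    (g : E S → ℝ≥0∞) : Z.exitMean V g x = 0 := by
  refine setLIntegral_measure_zero _ _ (measure_mono_null (t := {ω | ¬ Z.X 0 ω = x}) ?_ (Z.start x))
  intro ω hω h0
  have hω : exitTime Z.X V ω < ∞ := hω
  simp only [exitTime, iInf_lt_iff] at hω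
  obtain ⟨s, ⟨-, hs⟩, -⟩ := hω
  rw [Z.absorbed ω 0 s zero_le (by rwa [h0]), h0] at hs
  exact hs hxV

theorem exitMean_eq_lintegral_escape [LocallyCompactSpace S] {V : Set (E S)} (hV : IsOpen V) {K : ℕ → Set (E S)}
    (hK : Exhausts K (V ∩ inner S)) {x : E S} (hx : x ∈ V ∩ inner S) {g : E S → ℝ≥0∞}
    (hg : ∀ y, y ∉ inner S → g y = 0) :
    Z.exitMean V g x = ∫⁻ ω in {ω | escape K (fun q => Z.X q ω) < Z.lifetime ω},
      g (Z.X (escape K fun q => Z.X q ω).toNNReal ω) ∂(Z.P x) := by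
  have hU := hV.inter (isOpen_inner S)
  have he : Measurable fun ω => escape K fun q => Z.X q ω :=
    (measurable_escape fun m => (hK.compact m).isClosed.measurableSet).comp Z.measurable_path
  have hmE : MeasurableSet {ω | escape K (fun q => Z.X q ω) < Z.lifetime ω} :=
    measurableSet_lt he Z.measurable_lifetime
  -- A measurable substitute, up to a null set, for the event that the exit time is finite. The
  -- second part records exits into the absorbing set; without an escape before `ζ` the exit
  -- position is in `∂E`, where `g` vanishes.
  let M : Set Ω := {ω | escape K (fun q => Z.X q ω) < Z.lifetime ω} ∪
    ⋃ q : ℚ≥0, Z.X q ⁻¹' (Vᶜ ∩ (inner S)ᶜ)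
  have hM : MeasurableSet M := hmE.union (MeasurableSet.iUnion fun q =>
    (hV.measurableSet.compl.inter (isOpen_inner S).measurableSet.compl).preimage (Z.measurable_X q))
  have hgood : ∀ᵐ ω ∂(Z.P x), (exitTime Z.X V ω < ∞ ↔ ω ∈ M) ∧
      (escape K (fun q => Z.X q ω) < Z.lifetime ω →
        exitTime Z.X V ω = escape K fun q => Z.X q ω) ∧
      (¬ escape K (fun q => Z.X q ω) < Z.lifetime ω → Z.lifetime ω ≤ exitTime Z.X V ω) := by
    filter_upwards [Z.start x, Z.ae_compact_containment x hK] with ω h0 hcc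
    have hX : ∀ s : ℝ≥0, (s : ℝ≥0∞) < Z.lifetime ω →
        ((s : ℝ≥0∞) < escape K (fun q => Z.X q ω) ↔ ∀ r ≤ s, Z.X r ω ∈ V ∩ inner S) := fun s hs =>
      lt_escape_iff hU hK (fun s _ => Z.right_continuous ω s) hcc hs
    have h1 : escape K (fun q => Z.X q ω) < Z.lifetime ω →
        exitTime Z.X V ω = escape K fun q => Z.X q ω := by
      intro hlt
      obtain ⟨a, ha⟩ : ∃ a : ℝ≥0, (a : ℝ≥0∞) = escape K fun q => Z.X q ω :=
        ⟨_, ENNReal.coe_toNNReal hlt.ne_top⟩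
      rw [← ha] at hlt hX ⊢
      have hlow : ∀ r < a, Z.X r ω ∈ V ∩ inner S := fun r hr =>
        (hX r (lt_trans (by exact_mod_cast hr) hlt)).1 (by exact_mod_cast hr) r le_rfl
      have haU : Z.X a ω ∉ V ∩ inner S := fun h => by
        refine lt_irrefl _ ((hX a hlt).2 fun r hr => ?_)
        rcases hr.eq_or_lt with rfl | hr
        · exact h
        · exact hlow r hr
      have haV : Z.X a ω ∉ V := fun h => haU ⟨h, (Z.mem_inner_iff a ω).2 hlt⟩
      have ha0 : 0 < a := by
        rw [pos_iff_ne_zero]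
        rintro rfl
        rw [h0] at haU
        exact haU hx
      refine le_antisymm (iInf₂_le a ⟨ha0, haV⟩) (le_iInf₂ fun s hs => ?_)
      by_contra hsa
      exact hs.2 (hlow s (by exact_mod_cast not_le.1 hsa)).1
    have h2 : ¬ escape K (fun q => Z.X q ω) < Z.lifetime ω →
        Z.lifetime ω ≤ exitTime Z.X V ω := by
      intro hle
      refine le_iInf₂ fun s hs => ?_
      by_contra hsl
      have hsl := not_le.1 hsl
      exact hs.2 ((hX s hsl).1 (hsl.trans_le (not_lt.1 hle)) s le_rfl).1
    refine ⟨⟨fun hτ => ?_, ?_⟩, h1, h2⟩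
    · by_cases hlt : escape K (fun q => Z.X q ω) < Z.lifetime ω
      · exact Or.inl hlt
      · right
        have hτ' := hτ
        simp only [exitTime, iInf_lt_iff] at hτ'
        obtain ⟨s, hs, -⟩ := hτ'
        have hsl : Z.lifetime ω ≤ s := (h2 hlt).trans (iInf₂_le s hs)
        have hsi : Z.X s ω ∉ inner S := fun h => absurd ((Z.mem_inner_iff s ω).1 h) (not_lt.2 hsl)
        obtain ⟨q, hq, -⟩ := exists_nnrat_btwn (show (s : ℝ≥0∞) < ∞ from ENNReal.coe_lt_top)
        have hXq := Z.absorbed ω s q (by exact_mod_cast hq.le) hsi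
        exact Set.mem_iUnion.2 ⟨q, by
          rw [Set.mem_preimage, hXq]
          exact ⟨hs.2, hsi⟩⟩
    · rintro (hlt | hq)
      · rw [h1 hlt]
        exact hlt.trans_le le_top
      · obtain ⟨q, hqV, hqi⟩ := Set.mem_iUnion.1 hq
        have hq0 : 0 < (q : ℝ≥0) := by
          rw [pos_iff_ne_zero]
          intro h
          rw [h, h0] at hqV
          exact hqV hx.1
        exact lt_of_le_of_lt (iInf₂_le (q : ℝ≥0) ⟨hq0, hqV⟩) ENNReal.coe_lt_top
  have hset : ({ω | exitTime Z.X V ω < ∞} : Set Ω) =ᵐ[Z.P x] M := by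
    filter_upwards [hgood] with ω hω
    exact propext hω.1
  rw [exitMean, setLIntegral_congr hset, ← lintegral_indicator hM, ← lintegral_indicator hmE]
  refine lintegral_congr_ae ?_
  filter_upwards [hgood] with ω hω
  by_cases hlt : escape K (fun q => Z.X q ω) < Z.lifetime ω
  · rw [Set.indicator_of_mem (show ω ∈ M from Or.inl hlt), Set.indicator_of_mem
      (s := {ω | escape K (fun q => Z.X q ω) < Z.lifetime ω}) hlt, hω.2.1 hlt]
  · rw [Set.indicator_of_notMem (s := {ω | escape K (fun q => Z.X q ω) < Z.lifetime ω}) hlt]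
    by_cases hωM : ω ∈ M
    · rw [Set.indicator_of_mem hωM]
      refine hg _ fun h => ?_
      rw [Z.mem_inner_iff, ENNReal.coe_toNNReal (hω.1.2 hωM).ne] at h
      exact absurd h (not_lt.2 (hω.2.2 hlt))
    · rw [Set.indicator_of_notMem hωM]

end Exit

end StandardProcess

/-! ### The Kelvin transform and exit means -/

namespace StandardProcess

variable {n : ℕ} {S : Set (EuclideanSpace ℝ (Fin n))} {Ω : Type*} [m₀ : MeasurableSpace Ω]
  {Z : StandardProcess S Ω} {I : E S → E S} {h : E S → ℝ≥0∞} {v : E S → ℝ}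

theorem continuousOn_image_of_isOpen {F : Type*} [TopologicalSpace F] {I : F → F}
    (hI : Function.Involutive I) {D : Set F} (hD : IsOpen D)
    (ho : ∀ O : Set F, IsOpen O → O ⊆ D → IsOpen (I '' O)) : ContinuousOn I (I '' D) := by
  rw [continuousOn_open_iff (ho D hD le_rfl)]
  intro t ht
  have : I '' D ∩ I ⁻¹' t = I '' (D ∩ t) := by
    rw [hI.image_eq_preimage_symm, Set.preimage_inter]
  rw [this]
  exact ho _ (hD.inter ht) Set.inter_subset_left

theorem _root_.KelvinIP.InversionProperty.measurable_kelvin (hIP : InversionProperty Z I h v)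
    {f : E S → EReal} (hf : Measurable f) : Measurable (kelvin h I f) :=
  (measurable_coe_ennreal_ereal.comp hIP.excessive.1).mul (hf.comp hIP.measurable)

variable [LocallyCompactSpace S]

/-- Compare survival at time `0`. From `x ∈ E°` the clock has positive total mass, so the inverted
process is alive almost surely; if `I x` were absorbing, the killed process from `I x` would have
mass zero. -/
theorem _root_.KelvinIP.InversionProperty.map_inner (hIP : InversionProperty Z I h v) {x : E S}
    (hx : x ∈ inner S) : I x ∈ inner S := by
  by_contra hIx
  have h1 := hIP.law x [(0, Set.univ)] (by simp)
  have hk : Z.killed 0 (I x) = 0 := by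
    have : Z.P (I x) {ω | ((0 : ℝ≥0) : ℝ≥0∞) < Z.lifetime ω} = 0 := by
      refine measure_mono_null (t := {ω | ¬ Z.X 0 ω = I x}) (fun ω hω h0 => ?_) (Z.start (I x))
      have := (Z.mem_inner_iff 0 ω).2 hω
      rw [h0] at this
      exact hIx this
    rw [killed, Measure.restrict_eq_zero.2 this, Measure.map_zero]
  have h2 : fddMass (Z.doob h) [(0, Set.univ)] (I x) = 0 := by
    simp [fddMass, doob, hk]
  have h3 : Z.P x (fddEvent (Z.inverted I v) 0 [(0, Set.univ)]) = 1 := by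
    rw [← measure_univ (μ := Z.P x)]
    refine measure_congr ?_
    filter_upwards [Z.start x, Z.ae_isClockRate hIP.v_continuous hIP.v_pos x] with ω h0 hφ
    refine propext ⟨fun _ => trivial, fun _ => ⟨?_, trivial⟩⟩
    refine (exists_inverted_iff I v _ ω Set.univ).2 ⟨Set.mem_univ _, ?_⟩
    have hl : ((0 : ℝ≥0) : ℝ≥0∞) < Z.lifetime ω := (Z.mem_inner_iff 0 ω).1 (by rwa [h0])
    have := hφ.lt_total hl
    rw [← clock_top] at this
    simpa using zero_le.trans_lt this
  rw [h2, h3] at h1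
  exact one_ne_zero h1

theorem _root_.KelvinIP.InversionProperty.map_inner_iff (hIP : InversionProperty Z I h v)
    {x : E S} : I x ∈ inner S ↔ x ∈ inner S :=
  ⟨fun hx => by simpa [hIP.involutive x] using hIP.map_inner hx, hIP.map_inner⟩

theorem _root_.KelvinIP.InversionProperty.image_inner (hIP : InversionProperty Z I h v) :
    I '' inner S = inner S := by
  rw [hIP.involutive.image_eq_preimage_symm]
  ext y
  exact hIP.map_inner_iff

/-- The Kelvin transform intertwines exit means of corresponding sets. -/
theorem exitMean_kelvin (hIP : InversionProperty Z I h v)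
    (hI : ∀ U : Set (E S), IsOpen U → U ⊆ finitePos h → IsOpen (I '' U))
    {V V' : Set (E S)} (hV : IsOpen V) (hV' : IsOpen V') (hVV' : I '' (V ∩ inner S) = V' ∩ inner S)
    {x : E S} (hx : x ∈ V ∩ inner S) {g : E S → ℝ≥0∞} (hgm : Measurable g)
    (hg : ∀ y, y ∉ inner S → g y = 0) :
    Z.exitMean V' (fun y => h y * g (I y)) (I x) = h (I x) * Z.exitMean V g x := by
  have hinner : inner S ⊆ finitePos h := fun y hy => ⟨hIP.h_pos y hy, hIP.h_lt_top y hy⟩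
  have hoi := isOpen_inner S
  have hIc : ContinuousOn I (inner S) := by
    have := continuousOn_image_of_isOpen hIP.involutive hoi fun O hO hOs =>
      hI O hO (hOs.trans hinner)
    rwa [hIP.image_inner] at this
  have hU := hV.inter hoi
  have hUi : V ∩ inner S ⊆ inner S := Set.inter_subset_right
  obtain ⟨K, hK⟩ := exists_exhausts hU
  have hIK : Exhausts (fun m => I '' K m) (I '' (V ∩ inner S)) :=
    hK.image (hIc.mono hUi) fun O hO hOs => hI O hO ((hOs.trans hUi).trans hinner)
  have hIx : I x ∈ V' ∩ inner S := hVV' ▸ ⟨x, hx, rfl⟩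
  have hIU : IsOpen (I '' (V ∩ inner S)) := hI _ hU (hUi.trans hinner)
  have hg' : ∀ y, y ∉ inner S → h y * g (I y) = 0 := fun y hy => by
    rw [hg _ (mt hIP.map_inner_iff.1 hy), mul_zero]
  rw [exitMean_eq_lintegral_escape hV' (hVV' ▸ hIK) hIx hg', exitMean_eq_lintegral_escape hV hK hx hg]
  have hKm : ∀ m, MeasurableSet (K m) := fun m => (hK.compact m).isClosed.measurableSet
  have hIKm : ∀ m, MeasurableSet (I '' K m) := fun m => (hIK.compact m).isClosed.measurableSet
  set e : Ω → ℝ≥0∞ := fun ω => escape K fun q => Z.X q ω with he_def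
  set e' : Ω → ℝ≥0∞ := fun ω => escape (fun m => I '' K m) fun q => Z.X q ω with he'_def
  have he : Measurable e := (measurable_escape hKm).comp Z.measurable_path
  have he' : Measurable e' := (measurable_escape hIKm).comp Z.measurable_path
  have hX : Measurable fun ω => Z.X (e ω).toNNReal ω :=
    Z.measurable_uncurry.comp (he.ennreal_toNNReal.prodMk measurable_id)
  have hX' : Measurable fun ω => Z.X (e' ω).toNNReal ω :=
    Z.measurable_uncurry.comp (he'.ennreal_toNNReal.prodMk measurable_id)
  have hIX : Measurable fun ω => I (Z.X (e ω).toNNReal ω) := hIP.measurable.comp hX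
  have hA : MeasurableSet {ω | e ω < Z.lifetime ω} := measurableSet_lt he Z.measurable_lifetime
  have hA' : MeasurableSet {ω | e' ω < Z.lifetime ω} := measurableSet_lt he' Z.measurable_lifetime
  have hk := hIP.excessive.measurable_indicator
  have hfin := hIP.h_lt_top _ hIx.2
  have hmem : ∀ (e : Ω → ℝ≥0∞) (ω : Ω), e ω < Z.lifetime ω ↔
      e ω < ∞ ∧ Z.X (e ω).toNNReal ω ∈ inner S := fun e ω => by
    rw [Z.mem_inner_iff]
    constructor
    · intro hlt
      exact ⟨hlt.trans_le le_top, by rwa [ENNReal.coe_toNNReal hlt.ne_top]⟩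
    · rintro ⟨h1, h2⟩
      rwa [ENNReal.coe_toNNReal h1.ne] at h2
  -- The weighted law of the escape position from `I x`, and below it the law of `I(X_e)` from `x`.
  -- They are compared on open sets, a generating π-system, and then integrated against `g ∘ I`.
  let μ₁ := (((Z.P (I x)).restrict {ω | e' ω < Z.lifetime ω}).withDensity
    fun ω => (inner S).indicator h (Z.X (e' ω).toNNReal ω)).map fun ω => Z.X (e' ω).toNNReal ω
  let μ₂ := h (I x) • ((Z.P x).restrict {ω | e ω < Z.lifetime ω}).map
    fun ω => I (Z.X (e ω).toNNReal ω)
  have e1 : ∀ O, IsOpen O → μ₁ O = μ₂ O := by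
    intro O hO
    -- Exhausting `O ∩ E°` instead of `O` makes the event force `X_e' ∈ E°`, that is `e' < ζ`.
    obtain ⟨G, hG⟩ := exists_exhausts (hO.inter hoi)
    have hGm : ∀ m, MeasurableSet (G m) := fun m => (hG.compact m).isClosed.measurableSet
    have hlaw := law_escape hIP hIx.2 hIKm hGm
    have hs1 : {ω | (fun q => Z.X q ω) ∈ escapeIn (fun m => I '' K m) G} ∩ {ω | e' ω < ∞} =
        (fun ω => Z.X (e' ω).toNNReal ω) ⁻¹' O ∩ {ω | e' ω < Z.lifetime ω} := by
      ext ω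
      simp only [Set.mem_inter_iff, Set.mem_ofPred_eq, Set.mem_preimage, hmem e' ω]
      have : e' ω < ∞ → ((fun q => Z.X q ω) ∈ escapeIn (fun m => I '' K m) G ↔
          Z.X (e' ω).toNNReal ω ∈ O ∩ inner S) := fun hlt =>
        mem_escapeIn_iff hG (ENNReal.coe_toNNReal hlt.ne).symm (Z.right_continuous ω _)
      constructor
      · rintro ⟨h1, h2⟩
        have h3 := (this h2).1 h1
        exact ⟨h3.1, h2, h3.2⟩
      · rintro ⟨h1, h2, h3⟩
        exact ⟨(this h2).2 ⟨h1, h3⟩, h2⟩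
    have hs2 : ({ω | Z.turned I v ω ∈ escapeIn (fun m => I '' K m) G} ∩
        {ω | escape (fun m => I '' K m) (Z.turned I v ω) < Z.clock v ∞ ω} : Set Ω) =ᵐ[Z.P x]
        ((fun ω => I (Z.X (e ω).toNNReal ω)) ⁻¹' O ∩ {ω | e ω < Z.lifetime ω} : Set Ω) := by
      filter_upwards [Z.ae_compact_containment x hK,
        Z.ae_isClockRate hIP.v_continuous hIP.v_pos x] with ω hcc hφ
      refine propext ((turned_escape_iff hφ hIP.involutive.injective hIc hU hIU hK hIK hG hcc).trans
        ?_)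
      constructor
      · rintro ⟨h1, h2⟩
        exact ⟨h2.1, h1⟩
      · rintro ⟨h1, h2⟩
        exact ⟨h2, h1, hIP.map_inner ((hmem e ω).1 h2).2⟩
    rw [hs1, measure_congr hs2] at hlaw
    simp only [μ₁, μ₂]
    rw [Measure.map_apply hX' hO.measurableSet, withDensity_apply _ (hX' hO.measurableSet),
      Measure.restrict_restrict (hX' hO.measurableSet), hlaw, Measure.smul_apply, smul_eq_mul,
      Measure.map_apply hIX hO.measurableSet,
      Measure.restrict_apply (hIX hO.measurableSet)]
  have hμfin : IsFiniteMeasure μ₁ := by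
    refine ⟨?_⟩
    rw [e1 _ isOpen_univ]
    simp only [μ₂, Measure.smul_apply, smul_eq_mul]
    exact ENNReal.mul_lt_top hfin (measure_lt_top _ _)
  have hμ : μ₁ = μ₂ := ext_of_generate_finite {O : Set (E S) | IsOpen O}
    (BorelSpace.measurable_eq (α := E S)) isPiSystem_isOpen (fun O hO => e1 O hO)
    (e1 _ isOpen_univ)
  have hgI : Measurable fun y => g (I y) := hgm.comp hIP.measurable
  have l1 : ∫⁻ y, g (I y) ∂μ₁ = ∫⁻ ω in {ω | e' ω < Z.lifetime ω},
      h (Z.X (e' ω).toNNReal ω) * g (I (Z.X (e' ω).toNNReal ω)) ∂(Z.P (I x)) := by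
    simp only [μ₁]
    have hkX : Measurable fun ω => (inner S).indicator h (Z.X (e' ω).toNNReal ω) := hk.comp hX'
    have hgX : Measurable fun ω => g (I (Z.X (e' ω).toNNReal ω)) := hgI.comp hX'
    rw [lintegral_map hgI hX', lintegral_withDensity_eq_lintegral_mul _ hkX hgX]
    refine setLIntegral_congr_fun hA' fun ω hω => ?_
    simp only [Pi.mul_apply, Set.indicator_of_mem ((hmem e' ω).1 hω).2]
  have l2 : ∫⁻ y, g (I y) ∂μ₂ = h (I x) * ∫⁻ ω in {ω | e ω < Z.lifetime ω},
      g (Z.X (e ω).toNNReal ω) ∂(Z.P x) := by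
    simp only [μ₂]
    rw [lintegral_smul_measure, smul_eq_mul, lintegral_map hgI hIX]
    simp only [hIP.involutive _]
  rw [← l1, ← l2, hμ]

theorem exitPos_kelvin (hIP : InversionProperty Z I h v)
    (hI : ∀ U : Set (E S), IsOpen U → U ⊆ finitePos h → IsOpen (I '' U))
    {V V' : Set (E S)} (hV : IsOpen V) (hV' : IsOpen V') (hVV' : I '' (V ∩ inner S) = V' ∩ inner S)
    {x : E S} (hx : x ∈ V ∩ inner S) {f : E S → EReal} (hfm : Measurable f)
    (hf : ∀ y, y ∉ inner S → f y = 0) :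
    Z.exitPos V' (kelvin h I f) (I x) = h (I x) * Z.exitPos V f x := by
  have h1 := exitMean_kelvin hIP hI hV hV' hVV' hx (g := fun y => (f y).toENNReal)
    hfm.ereal_toENNReal (fun y hy => by simp [hf y hy])
  rw [exitPos, exitPos, ← h1]
  congr 1
  funext y
  rw [kelvin, EReal.toENNReal_mul (EReal.coe_ennreal_nonneg _), EReal.toENNReal_coe]

theorem exitNeg_kelvin (hIP : InversionProperty Z I h v)
    (hI : ∀ U : Set (E S), IsOpen U → U ⊆ finitePos h → IsOpen (I '' U))
    {V V' : Set (E S)} (hV : IsOpen V) (hV' : IsOpen V') (hVV' : I '' (V ∩ inner S) = V' ∩ inner S)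
    {x : E S} (hx : x ∈ V ∩ inner S) {f : E S → EReal} (hfm : Measurable f)
    (hf : ∀ y, y ∉ inner S → f y = 0) :
    Z.exitNeg V' (kelvin h I f) (I x) = h (I x) * Z.exitNeg V f x := by
  have h1 := exitPos_kelvin hIP hI hV hV' hVV' hx (f := fun y => -f y) hfm.neg
    (fun y hy => by simp [hf y hy])
  have h2 : kelvin h I (fun y => -f y) = fun y => -kelvin h I f y := by
    funext y
    simp [kelvin, mul_neg]
  rw [h2] at h1
  exact h1

/-- Finiteness of `c` is essential for distributivity in `EReal`; it is available because `c` will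
be the value of `h` at a point of `E°`. -/
theorem coe_mul_sub_coe_mul {c : ℝ≥0∞} (hc : c ≠ ∞) (a b : ℝ≥0∞) :
    ((c * a : ℝ≥0∞) : EReal) - ((c * b : ℝ≥0∞) : EReal) = c * ((a : EReal) - b) := by
  rw [EReal.coe_ennreal_mul, EReal.coe_ennreal_mul, sub_eq_add_neg, sub_eq_add_neg,
    EReal.left_distrib_of_nonneg_of_ne_top (EReal.coe_ennreal_nonneg _)
      (by rwa [Ne, EReal.coe_ennreal_eq_top_iff]), mul_neg]

/-- The Kelvin transform of a regular harmonic function is regular harmonic. -/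
theorem regularHarmonicOn_kelvin (hIP : InversionProperty Z I h v)
    (hI : ∀ U : Set (E S), IsOpen U → U ⊆ finitePos h → IsOpen (I '' U))
    {D : Set (E S)} (hD : IsOpen D) (hDh : D ⊆ finitePos h) {f : E S → EReal}
    (hfD : Z.RegularHarmonicOn D f) (hf0 : ∀ x, x ∉ inner S → x ∉ D → f x = 0) :
    Z.RegularHarmonicOn (I '' D) (kelvin h I f) := by
  have hID : IsOpen (I '' D) := hI D hD hDh
  obtain ⟨hfm, hf⟩ := hfD
  -- An absorbing point of `D` never exits `D`, so the mean value identity itself forces `f` to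
  -- vanish there.
  have hf0' : ∀ y, y ∉ inner S → f y = 0 := fun y hy => by
    by_cases hyD : y ∈ D
    · obtain ⟨-, -, h3⟩ := hf y hyD
      rw [← h3, exitPos, exitNeg,
        exitMean_of_notMem_inner hy hyD,
        exitMean_of_notMem_inner hy hyD]
      simp
    · exact hf0 y hy hyD
  refine ⟨hIP.measurable_kelvin hfm, ?_⟩
  rintro _ ⟨x, hxD, rfl⟩
  by_cases hx : x ∈ inner S
  · have hVV' : I '' (D ∩ inner S) = I '' D ∩ inner S := by
      rw [Set.image_inter hIP.involutive.injective, hIP.image_inner]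
    obtain ⟨h1, h2, h3⟩ := hf x hxD
    have hfin := hIP.h_lt_top _ (hIP.map_inner hx)
    rw [exitPos_kelvin hIP hI hD hID hVV' ⟨hxD, hx⟩ hfm hf0',
      exitNeg_kelvin hIP hI hD hID hVV' ⟨hxD, hx⟩ hfm hf0']
    refine ⟨ENNReal.mul_lt_top hfin h1, ENNReal.mul_lt_top hfin h2, ?_⟩
    rw [coe_mul_sub_coe_mul hfin.ne, h3, kelvin, hIP.involutive x]
  · have hIx : I x ∉ inner S := mt hIP.map_inner_iff.1 hx
    rw [exitPos, exitNeg,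
      exitMean_of_notMem_inner hIx (Set.mem_image_of_mem I hxD),
      exitMean_of_notMem_inner hIx (Set.mem_image_of_mem I hxD), kelvin, hIP.involutive x,
      hf0' x hx]
    simp

/-- The Kelvin transform of a superharmonic function is superharmonic. -/
theorem superharmonicOn_kelvin (hIP : InversionProperty Z I h v)
    (hI : ∀ U : Set (E S), IsOpen U → U ⊆ finitePos h → IsOpen (I '' U))
    {D : Set (E S)} (hD : IsOpen D) (hDh : D ⊆ finitePos h) {f : E S → EReal}
    (hfD : Z.SuperharmonicOn D f) (hf0 : ∀ x, x ∉ inner S → f x = 0) :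
    Z.SuperharmonicOn (I '' D) (kelvin h I f) := by
  have hII : ∀ B : Set (E S), I '' (I '' B) = B := fun B => by
    rw [← Set.image_comp, hIP.involutive.comp_self, Set.image_id]
  obtain ⟨hfm, hf⟩ := hfD
  refine ⟨hIP.measurable_kelvin hfm, fun B' hB' hcl y hy => ?_⟩
  by_cases hyi : y ∈ inner S
  · have hinner : inner S ⊆ finitePos h := fun y hy => ⟨hIP.h_pos y hy, hIP.h_lt_top y hy⟩
    have hIinnerOpen : ∀ O : Set (E S), IsOpen O → O ⊆ inner S → IsOpen (I '' O) :=
      fun O hO hOs => hI O hO (hOs.trans hinner)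
    -- Only the part of `B'` in `E°` is pulled back: `hI` gives openness of images only inside
    -- `finitePos h`, which need not contain `B'`. The discarded part does not affect exit means,
    -- since `f` vanishes on `∂E`.
    have hB : IsOpen (I '' (B' ∩ inner S)) :=
      hIinnerOpen _ (hB'.inter (isOpen_inner S)) Set.inter_subset_right
    have hBi : I '' (B' ∩ inner S) ∩ inner S = I '' (B' ∩ inner S) := by
      rw [Set.inter_eq_left, Set.image_inter hIP.involutive.injective, hIP.image_inner]
      exact Set.inter_subset_right
    have hVV' : I '' (I '' (B' ∩ inner S) ∩ inner S) = B' ∩ inner S := by rw [hBi, hII]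
    have hcont : ContinuousOn I (I '' D) :=
      continuousOn_image_of_isOpen hIP.involutive hD fun O hO hOs =>
        hI O hO (hOs.trans hDh)
    -- `E` is compact, so `closure B'` is compact; its image under `I`, continuous on `I '' D`, is
    -- compact and hence closed.
    have hclB : closure (I '' (B' ∩ inner S)) ⊆ D := by
      have hcomp : IsCompact (I '' closure B') :=
        isClosed_closure.isCompact.image_of_continuousOn (hcont.mono hcl)
      refine (closure_minimal (Set.image_mono (Set.inter_subset_left.trans subset_closure))
        hcomp.isClosed).trans ?_
      rw [← hII D]
      exact Set.image_mono hcl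
    have hIy : I y ∈ I '' (B' ∩ inner S) := ⟨y, ⟨hy, hyi⟩, rfl⟩
    obtain ⟨h1, h2⟩ := hf _ hB hclB (I y) hIy
    have hIy' : I y ∈ I '' (B' ∩ inner S) ∩ inner S := hBi.symm ▸ hIy
    have e1 := exitPos_kelvin hIP hI hB hB' hVV' hIy' hfm hf0
    have e2 := exitNeg_kelvin hIP hI hB hB' hVV' hIy' hfm hf0
    rw [hIP.involutive y] at e1 e2
    have hfin := hIP.h_lt_top y hyi
    rw [e1, e2]
    refine ⟨h1.imp (ENNReal.mul_lt_top hfin) (ENNReal.mul_lt_top hfin), ?_⟩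
    rw [coe_mul_sub_coe_mul hfin.ne, kelvin]
    exact mul_le_mul_of_nonneg_left h2 (EReal.coe_ennreal_nonneg _)
  · rw [exitPos, exitNeg,
      exitMean_of_notMem_inner hyi hy,
      exitMean_of_notMem_inner hyi hy, kelvin,
      hf0 _ (mt hIP.map_inner_iff.1 hyi)]
    simp

end StandardProcess

end KelvinIP

end

theorem theorem2p1 {n : ℕ} (S : Set (EuclideanSpace ℝ (Fin n))) [LocallyCompactSpace S]
    (hS0 : (0 : EuclideanSpace ℝ (Fin n)) ∈ S) (hSb : ¬ Bornology.IsBounded S)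
    {Ω : Type*} [MeasurableSpace Ω] (Z : KelvinIP.StandardProcess S Ω)
    (I : KelvinIP.E S → KelvinIP.E S) (h : KelvinIP.E S → ℝ≥0∞) (v : KelvinIP.E S → ℝ)
    (hIP : KelvinIP.InversionProperty Z I h v)
    (hI : ∀ U : Set (KelvinIP.E S), IsOpen U → U ⊆ KelvinIP.finitePos h → IsOpen (I '' U))
    (D : Set (KelvinIP.E S)) (hD : IsOpen D) (hDh : D ⊆ KelvinIP.finitePos h) :
    (∀ f : KelvinIP.E S → EReal, Z.RegularHarmonicOn D f →
      (∀ x, x ∉ KelvinIP.inner S → x ∉ D → f x = 0) →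
      Z.RegularHarmonicOn (I '' D) (KelvinIP.kelvin h I f)) ∧
    (∀ f : KelvinIP.E S → EReal, Z.SuperharmonicOn D f →
      (∀ x, x ∉ KelvinIP.inner S → f x = 0) →
      Z.SuperharmonicOn (I '' D) (KelvinIP.kelvin h I f)) := by
  exact ⟨fun _ hf hf0 => KelvinIP.StandardProcess.regularHarmonicOn_kelvin hIP hI hD hDh hf hf0,
    fun _ hf hf0 => KelvinIP.StandardProcess.superharmonicOn_kelvin hIP hI hD hDh hf hf0⟩
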